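/- Let $\mathrm{E}$ be the set of sixteen symbols $(0)$, $(ij)$ for $1\le i<j\le 5$, and $(k)$ for $1\le k\le 5$, and let $\hat{\mathrm{E}}=\mathrm{E}\times\mathbb{Z}$, whose elements are written $\alpha^r$. Make $\hat{\mathrm{E}}$ a directed graph with, for every $r\in\mathbb{Z}$, the arrows $(0)^r\to(12)^r\to(13)^r$; $(13)^r\to(23)^r$; $(13)^r\to(14)^r$; $(23)^r\to(24)^r$; $(14)^r\to(24)^r$; $(14)^r\to(15)^r$; $(24)^r\to(34)^r$; $(24)^r\to(25)^r$; $(15)^r\to(25)^r$; $(34)^r\to(5)^r$; $(34)^r\to(35)^r$; $(25)^r\to(35)^r$; $(5)^r\to(4)^r$; $(35)^r\to(4)^r$; $(35)^r\to(45)^r$; $(4)^r\to(3)^r$; $(45)^r\to(3)^r$; $(3)^r\to(2)^r\to(1)^r$; and $(45)^{r}\to(0)^{r+1}$; $(3)^{r}\to(12)^{r+1}$; $(2)^{r}\to(13)^{r+1}$; $(1)^{r}\to(23)^{r+1}$. Put $\hat\alpha\le\hat\beta$ if there is a directed path from $\hat\alpha$ to $\hat\beta$; this is a partial order. Let $\mathrm{ht}:\hat{\mathrm{E}}\to\mathbb{Z}$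 be the unique function with $\mathrm{ht}((0)^0)=0$ and $\mathrm{ht}(\hat\beta)=\mathrm{ht}(\hat\alpha)+1$ for every arrow $\hat\alpha\to\hat\beta$. Write a spinor as $(\lambda,w_{ij},p_k)=(\lambda^{\alpha})_{\alpha\in\mathrm{E}}$ with $\lambda=\lambda^{(0)}$, $w_{ij}=\lambda^{(ij)}$, $p_k=\lambda^{(k)}$, and consider the ten quadratic forms that define the pure spinors (the affine cone over $\mathrm{OGr}^+(5,10)$): $$\begin{aligned} \Gamma^{1}&=\lambda p_1+w_{25}w_{34}-w_{24}w_{35}+w_{23}w_{45}, & \Gamma^{1^*}&=-p_2w_{12}+p_3w_{13}-p_4w_{14}+p_5w_{15},\\ \Gamma^{2}&=-\lambda p_2-w_{15}w_{34}+w_{14}w_{35}-w_{13}w_{45}, & \Gamma^{2^*}&=-p_1w_{12}+p_3w_{23}-p_4w_{24}+p_5w_{25},\\ \Gamma^{3}&=\lambda p_3+w_{15}w_{24}-w_{14}w_{25}+w_{12}w_{45}, & \Gamma^{3^*}&=-p_1w_{13}+p_2w_{23}-p_4w_{34}+p_5w_{35},\\ \Gamma^{4}&=-\lambda p_4-w_{15}w_{23}+w_{13}w_{25}-w_{12}w_{35},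 & \Gamma^{4^*}&=-p_1w_{14}+p_2w_{24}-p_3w_{34}+p_5w_{45},\\ \Gamma^{5}&=\lambda p_5+w_{14}w_{23}-w_{13}w_{24}+w_{12}w_{34}, & \Gamma^{5^*}&=-p_1w_{15}+p_2w_{25}-p_3w_{35}+p_4w_{45}. \end{aligned}$$ For $\hat\delta\le\hat\delta'$ in $\hat{\mathrm{E}}$ let $[\hat\delta,\hat\delta']=\{\hat\alpha:\hat\delta\le\hat\alpha\le\hat\delta'\}$ (a finite set), and let $A_{\hat\delta}^{\hat\delta'}$ be the quotient of the polynomial ring $\mathbb{C}[\lambda^{\hat\alpha}:\hat\alpha\in[\hat\delta,\hat\delta']]$ by the ideal generated by all coefficients of powers of $z$ in the ten Laurent polynomials $\Gamma^{\mathbf{s}}(\lambda(z))$, where $\lambda^{\alpha}(z)=\sum_{l:\,\alpha^l\in[\hat\delta,\hat\delta']}\lambda^{\alpha^l}z^l$. The depth of $A_{\hat\delta}^{\hat\delta'}$ is the maximal length of a regular sequence of $A_{\hat\delta}^{\hat\delta'}$ contained in the ideal generated by all $\lambda^{\hat\alpha}$. Proposition. For all $\hat\delta\le\hat\delta'$ in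 $\hat{\mathrm{E}}$, $$\mathrm{depth}(A_{\hat\delta}^{\hat\delta'})=\dim\mathrm{Spec}(A_{\hat\delta}^{\hat\delta'})=\mathrm{ht}(\hat\delta')-\mathrm{ht}(\hat\delta)+1 .$$ Moreover, with $y_i=\sum_{\hat\alpha\in[\hat\delta,\hat\delta'],\ \mathrm{ht}(\hat\alpha)=i}\lambda^{\hat\alpha}$, the elements $y_{\mathrm{ht}(\hat\delta)},y_{\mathrm{ht}(\hat\delta)+1},\dots,y_{\mathrm{ht}(\hat\delta')}$ form, in this order, a regular sequence in $A_{\hat\delta}^{\hat\delta'}$. -/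

import Mathlib

namespace PureSpinor

/-- The sixteen weights of the half-spin representation of `Spin(10)`:
`e0` is `(0)`, `wij` is `(ij)` and `pk` is `(k)`. -/
inductive Weight : Type
  | e0
  | w12 | w13 | w14 | w15 | w23 | w24 | w25 | w34 | w35 | w45
  | p1 | p2 | p3 | p4 | p5
  deriving DecidableEq

instance : Fintype Weight where
  elems := {.e0, .w12, .w13, .w14, .w15, .w23, .w24, .w25, .w34, .w35, .w45,
    .p1, .p2, .p3, .p4, .p5}
  complete x := by cases x <;> decide

/-- The affine weights `α^r`, with `α` a weight of the half-spin representation and `r` an integer.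
This is a structure and not a product, so that it inherits no order. -/
@[ext]
structure AffWeight : Type where
  weight : Weight
  level : ℤ

/-- The arrows of the Hasse diagram of the affine weights: the twenty arrows of the diagram of the
half-spin representation at each level `r`, and four arrows from level `r` to level `r + 1`. -/
inductive Arrow : AffWeight → AffWeight → Prop
  | a01 (r : ℤ) : Arrow ⟨.e0, r⟩ ⟨.w12, r⟩
  | a02 (r : ℤ) : Arrow ⟨.w12, r⟩ ⟨.w13, r⟩
  | a03 (r : ℤ) : Arrow ⟨.w13, r⟩ ⟨.w23, r⟩
  | a04 (r : ℤ) : Arrow ⟨.w13, r⟩ ⟨.w14, r⟩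
  | a05 (r : ℤ) : Arrow ⟨.w23, r⟩ ⟨.w24, r⟩
  | a06 (r : ℤ) : Arrow ⟨.w14, r⟩ ⟨.w24, r⟩
  | a07 (r : ℤ) : Arrow ⟨.w14, r⟩ ⟨.w15, r⟩
  | a08 (r : ℤ) : Arrow ⟨.w24, r⟩ ⟨.w34, r⟩
  | a09 (r : ℤ) : Arrow ⟨.w24, r⟩ ⟨.w25, r⟩
  | a10 (r : ℤ) : Arrow ⟨.w15, r⟩ ⟨.w25, r⟩
  | a11 (r : ℤ) : Arrow ⟨.w34, r⟩ ⟨.p5, r⟩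
  | a12 (r : ℤ) : Arrow ⟨.w34, r⟩ ⟨.w35, r⟩
  | a13 (r : ℤ) : Arrow ⟨.w25, r⟩ ⟨.w35, r⟩
  | a14 (r : ℤ) : Arrow ⟨.p5, r⟩ ⟨.p4, r⟩
  | a15 (r : ℤ) : Arrow ⟨.w35, r⟩ ⟨.p4, r⟩
  | a16 (r : ℤ) : Arrow ⟨.w35, r⟩ ⟨.w45, r⟩
  | a17 (r : ℤ) : Arrow ⟨.p4, r⟩ ⟨.p3, r⟩
  | a18 (r : ℤ) : Arrow ⟨.w45, r⟩ ⟨.p3, r⟩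
  | a19 (r : ℤ) : Arrow ⟨.p3, r⟩ ⟨.p2, r⟩
  | a20 (r : ℤ) : Arrow ⟨.p2, r⟩ ⟨.p1, r⟩
  | b01 (r : ℤ) : Arrow ⟨.w45, r⟩ ⟨.e0, r + 1⟩
  | b02 (r : ℤ) : Arrow ⟨.p3, r⟩ ⟨.w12, r + 1⟩
  | b03 (r : ℤ) : Arrow ⟨.p2, r⟩ ⟨.w13, r + 1⟩
  | b04 (r : ℤ) : Arrow ⟨.p1, r⟩ ⟨.w23, r + 1⟩

/-- The height of a weight at level zero. -/
def Weight.ht : Weight → ℤ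
  | .e0 => 0
  | .w12 => 1
  | .w13 => 2
  | .w14 => 3
  | .w23 => 3
  | .w15 => 4
  | .w24 => 4
  | .w25 => 5
  | .w34 => 5
  | .w35 => 6
  | .p5 => 6
  | .w45 => 7
  | .p4 => 7
  | .p3 => 8
  | .p2 => 9
  | .p1 => 10

/-- The height of an affine weight. It is the unique integer-valued function that vanishes at
`(0)^0` and increases by one along every arrow (the diagram is connected). -/
def ht (a : AffWeight) : ℤ := 8 * a.level + a.weight.ht

theorem ht_arrow {a b : AffWeight} (h : Arrow a b) : ht a + 1 = ht b := by
  cases h <;> simp only [ht, Weight.ht] <;> ring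

theorem ht_le_of_path {a b : AffWeight} (h : Relation.ReflTransGen Arrow a b) :
    a = b ∨ ht a < ht b := by
  induction h with
  | refl => exact Or.inl rfl
  | tail _ hbc ih =>
    have := ht_arrow hbc
    rcases ih with rfl | ih
    · right; omega
    · right; omega

/-- `a ≤ b` if there is a directed path from `a` to `b` in the diagram. -/
instance : PartialOrder AffWeight where
  le a b := Relation.ReflTransGen Arrow a b
  le_refl _ := Relation.ReflTransGen.refl
  le_trans _ _ _ := Relation.ReflTransGen.trans
  le_antisymm a b hab hba := by
    rcases ht_le_of_path hab with h | h
    · exact h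
    · rcases ht_le_of_path hba with h' | h'
      · exact h'.symm
      · omega

theorem ht_mono {a b : AffWeight} (h : a ≤ b) : ht a ≤ ht b := by
  rcases ht_le_of_path h with rfl | h
  · exact le_rfl
  · exact h.le

theorem finite_Icc (d d' : AffWeight) : (Set.Icc d d').Finite := by
  refine (((Set.finite_univ (α := Weight)).prod
    (Set.finite_Icc (ht d - 10) (ht d' + 10))).image
      (fun x : Weight × ℤ => (⟨x.1, (x.2 / 8 : ℤ)⟩ : AffWeight))).subset ?_
  rintro ⟨w, r⟩ ⟨h1, h2⟩
  have h1' := ht_mono h1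
  have h2' := ht_mono h2
  refine ⟨(w, 8 * r), ⟨Set.mem_univ _, ?_⟩, ?_⟩
  · cases w <;> simp only [ht, Weight.ht, Set.mem_Icc] at h1' h2' ⊢ <;> omega
  · simp

noncomputable instance (d d' : AffWeight) : Fintype (Set.Icc d d') :=
  (finite_Icc d d').fintype

/-- Indices of the standard basis of the ten-dimensional vector representation:
`v1, …, v5` and the dual `v1s, …, v5s`. -/
inductive VecIndex : Type
  | v1 | v2 | v3 | v4 | v5
  | v1s | v2s | v3s | v4s | v5s

/-- The ten quadratic forms `Γ^s` in the sixteen coordinates of a spinor whose common zeros are the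
pure spinors, over any commutative ring. -/
def Gam {R : Type*} [CommRing R] (s : VecIndex) (x : Weight → R) : R :=
  match s with
  | .v1 => x .e0 * x .p1 + x .w25 * x .w34 - x .w24 * x .w35 + x .w23 * x .w45
  | .v2 => -(x .e0 * x .p2) - x .w15 * x .w34 + x .w14 * x .w35 - x .w13 * x .w45
  | .v3 => x .e0 * x .p3 + x .w15 * x .w24 - x .w14 * x .w25 + x .w12 * x .w45
  | .v4 => -(x .e0 * x .p4) - x .w15 * x .w23 + x .w13 * x .w25 - x .w12 * x .w35
  | .v5 => x .e0 * x .p5 + x .w14 * x .w23 - x .w13 * x .w24 + x .w12 * x .w34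
  | .v1s => -(x .p2 * x .w12) + x .p3 * x .w13 - x .p4 * x .w14 + x .p5 * x .w15
  | .v2s => -(x .p1 * x .w12) + x .p3 * x .w23 - x .p4 * x .w24 + x .p5 * x .w25
  | .v3s => -(x .p1 * x .w13) + x .p2 * x .w23 - x .p4 * x .w34 + x .p5 * x .w35
  | .v4s => -(x .p1 * x .w14) + x .p2 * x .w24 - x .p3 * x .w34 + x .p5 * x .w45
  | .v5s => -(x .p1 * x .w15) + x .p2 * x .w25 - x .p3 * x .w35 + x .p4 * x .w45

/-- The polynomial algebra over `ℂ` on the variables `λ^a`, `a ∈ [d, d']`. -/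
abbrev Poly (d d' : AffWeight) : Type := MvPolynomial (Set.Icc d d') ℂ

/-- The generating function `λ^α(z) = ∑ λ^{α^l} z^l`, the sum over all `l` with `α^l ∈ [d, d']`. -/
noncomputable def genFun (d d' : AffWeight) (α : Weight) : LaurentPolynomial (Poly d d') :=
  ∑ a : Set.Icc d d',
    if a.1.weight = α then
      LaurentPolynomial.C (MvPolynomial.X a : Poly d d') * LaurentPolynomial.T a.1.level
    else 0

/-- The relation `Γ^{s^l}`: the coefficient of `z^l` in `Γ^s(λ(z))`. -/
noncomputable def rel (d d' : AffWeight) (s : VecIndex) (l : ℤ) : Poly d d' :=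
  (Gam s (genFun d d')).coeff l

/-- The ideal generated by all relations `Γ^{s^l}`. -/
noncomputable def relIdeal (d d' : AffWeight) : Ideal (Poly d d') :=
  Ideal.span (Set.range fun p : VecIndex × ℤ => rel d d' p.1 p.2)

/-- The algebra `A_d^{d'}`. -/
abbrev Alg (d d' : AffWeight) : Type := Poly d d' ⧸ relIdeal d d'

/-- The generator `λ^a` of `A_d^{d'}`. -/
noncomputable def gen (d d' : AffWeight) (a : Set.Icc d d') : Alg d d' :=
  Ideal.Quotient.mk (relIdeal d d') (MvPolynomial.X a)

/-- The ideal of `A_d^{d'}` generated by all `λ^a`. -/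
noncomputable def genIdeal (d d' : AffWeight) : Ideal (Alg d d') :=
  Ideal.span (Set.range (gen d d'))

/-- The supremum of the lengths of the regular sequences of `R` that lie in the ideal `I`. -/
noncomputable def depthIn {R : Type*} [CommRing R] (I : Ideal R) : ℕ∞ :=
  ⨆ (rs : List R) (_ : RingTheory.Sequence.IsRegular R rs) (_ : ∀ r ∈ rs, r ∈ I),
    (rs.length : ℕ∞)

/-- The depth of `A_d^{d'}`. -/
noncomputable def depth (d d' : AffWeight) : ℕ∞ := depthIn (genIdeal d d')

/-- The rank-sum `y_i`: the sum of all generators `λ^a` with `ht a = i`. -/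
noncomputable def rankSum (d d' : AffWeight) (i : ℤ) : Alg d d' :=
  ∑ a : Set.Icc d d', if ht a.1 = i then gen d d' a else 0

end PureSpinor

/-! The algebra of an interval has a standard monomial theory, and its rank sums are handled as in
the Stanley–Reisner ring of a poset. The order is the coordinatewise order in simple-root
coordinates (`le_iff_rootCoord_le`), which reduces its combinatorics to finite checks. In particular
the elements covering `a` inside `[a, d]` are either a single one, or two with a join of height `ht
a + 2` (`covers_of_lt`). Spanning: for an incomparable pair `a`, `b`, some coefficient of some `Γ^s`
contains `λ^a λ^b` as its unique term of smallest height gap. Rewriting by these relations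
terminates, so monomials supported on chains span (`exists_std`). Independence: if `d'` covers `d''`
by an edge with label `i`, the `i`-th root subgroup preserves the quadrics and moves spinors
supported on `[d, d'']` to spinors supported on `[d, d']`. The lowest coefficient in its parameter
sends a nonzero standard polynomial to a nonzero standard polynomial on the smaller interval.
Induction gives a map to a polynomial ring in `ht d' - ht d + 1` variables that is injective on
standard polynomials (`exists_embedding`). Hence the algebra is a domain with the standard monomials
as basis, and its dimension is at most that number. Regularity: let `J_m` be the ideal of the
quotient in which only the variables of `[m, d']` survive. Modulo `J_m` the rank sum of height `ht
m` is the nonzero element `λ^m` of a domain. Adding it to `J_m` gives `J_b` for a unique cover `b`,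
or `J_b ⊓ J_c` for two covers, where `J_b ⊔ J_c = J_e` for the join `e`. A Mayer–Vietoris argument
(`quotient_inf`) then propagates regularity downwards from the top element. The rank sums thus form
a regular sequence of the full length. Since no regular sequence is longer than the dimension, depth
and dimension both equal this length. -/

namespace PureSpinor

/-! ### Root coordinates of the affine weights -/

/-- The coordinates of a weight with respect to the simple roots: the number of edges of each label
on a path from `e0`. -/
def Weight.rootCoord : Weight → Fin 6 → ℤ
  | .e0 => ![0, 0, 0, 0, 0, 0]
  | .w12 => ![0, 0, 0, 0, 0, 1]
  | .w13 => ![0, 0, 1, 0, 0, 1]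
  | .w14 => ![0, 0, 1, 1, 0, 1]
  | .w23 => ![0, 1, 1, 0, 0, 1]
  | .w15 => ![0, 0, 1, 1, 1, 1]
  | .w24 => ![0, 1, 1, 1, 0, 1]
  | .w25 => ![0, 1, 1, 1, 1, 1]
  | .w34 => ![0, 1, 2, 1, 0, 1]
  | .w35 => ![0, 1, 2, 1, 1, 1]
  | .p5 => ![0, 1, 2, 1, 0, 2]
  | .w45 => ![0, 1, 2, 2, 1, 1]
  | .p4 => ![0, 1, 2, 1, 1, 2]
  | .p3 => ![0, 1, 2, 2, 1, 2]
  | .p2 => ![0, 1, 3, 2, 1, 2]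
  | .p1 => ![0, 2, 3, 2, 1, 2]

/-- The coordinates of the minimal imaginary root with respect to the affine simple roots. -/
def deltaCoord : Fin 6 → ℤ := ![1, 1, 2, 2, 1, 1]

/-- The coordinates of an affine weight with respect to the affine simple roots. -/
def rootCoord (a : AffWeight) (i : Fin 6) : ℤ := a.weight.rootCoord i + a.level * deltaCoord i

/-- If `v^s` minus the `i`-th affine simple root is an affine weight `u^(s - k)`,
then `lower i v = some (u, k)`. -/
def lower : Fin 6 → Weight → Option (Weight × ℤ)
  | 0 => fun
    | .e0 => some (.w45, 1)
    | .w12 => some (.p3, 1)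
    | .w13 => some (.p2, 1)
    | .w23 => some (.p1, 1)
    | _ => none
  | 1 => fun
    | .w23 => some (.w13, 0)
    | .w24 => some (.w14, 0)
    | .w25 => some (.w15, 0)
    | .p1 => some (.p2, 0)
    | _ => none
  | 2 => fun
    | .w13 => some (.w12, 0)
    | .w34 => some (.w24, 0)
    | .w35 => some (.w25, 0)
    | .p2 => some (.p3, 0)
    | _ => none
  | 3 => fun
    | .w14 => some (.w13, 0)
    | .w24 => some (.w23, 0)
    | .w45 => some (.w35, 0)
    | .p3 => some (.p4, 0)
    | _ => none
  | 4 => fun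
    | .w15 => some (.w14, 0)
    | .w25 => some (.w24, 0)
    | .w35 => some (.w34, 0)
    | .p4 => some (.p5, 0)
    | _ => none
  | 5 => fun
    | .w12 => some (.e0, 0)
    | .p5 => some (.w34, 0)
    | .p4 => some (.w35, 0)
    | .p3 => some (.w45, 0)
    | _ => none

/-- `b` is obtained from `a` by adding the `i`-th affine simple root. -/
def Step (i : Fin 6) (a b : AffWeight) : Prop :=
  ∀ j, rootCoord b j = rootCoord a j + if j = i then 1 else 0

theorem Weight.rootCoord_zero (u : Weight) : u.rootCoord 0 = 0 := by
  cases u <;> rfl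

theorem deltaCoord_zero : deltaCoord 0 = 1 := rfl

theorem one_le_deltaCoord : ∀ i, 1 ≤ deltaCoord i := by decide

theorem rootCoord_zero (a : AffWeight) : rootCoord a 0 = a.level := by
  simp [rootCoord, Weight.rootCoord_zero, deltaCoord_zero]

theorem Weight.rootCoord_injective :
    ∀ u v : Weight, (∀ i, u.rootCoord i = v.rootCoord i) → u = v := by
  decide +kernel

theorem rootCoord_injective {a b : AffWeight} (h : ∀ i, rootCoord a i = rootCoord b i) :
    a = b := by
  have h0 := h 0
  rw [rootCoord_zero, rootCoord_zero] at h0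
  refine AffWeight.ext (Weight.rootCoord_injective _ _ fun i => ?_) h0
  have := h i
  simp only [rootCoord, h0] at this
  linarith

/-- This bound makes any two affine weights at least three levels apart comparable, so that later
case checks involve only level differences up to two. -/
theorem Weight.rootCoord_le_add : ∀ (u v : Weight) (i : Fin 6),
    u.rootCoord i ≤ v.rootCoord i + 2 * deltaCoord i := by
  decide +kernel

theorem rootCoord_lt_of_level {a b : AffWeight} (h : a.level + 3 ≤ b.level) (i : Fin 6) :
    rootCoord a i < rootCoord b i := by
  have h1 := Weight.rootCoord_le_add a.weight b.weight i
  have h2 := one_le_deltaCoord i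
  have h3 : (a.level + 3) * deltaCoord i ≤ b.level * deltaCoord i :=
    mul_le_mul_of_nonneg_right h (by lia)
  simp only [rootCoord]
  linarith

theorem ht_eq_sum_rootCoord (a : AffWeight) : ht a = ∑ i, rootCoord a i := by
  have : ∀ u : Weight, u.ht = ∑ i, u.rootCoord i := by decide +kernel
  simp only [ht, rootCoord, Finset.sum_add_distrib, ← Finset.mul_sum, this]
  have : ∑ i, deltaCoord i = 8 := by decide
  rw [this]
  ring

theorem lower_spec : ∀ (i : Fin 6) (v u : Weight) (k : Fin 2), lower i v = some (u, (k : ℤ)) →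
    ∀ j, v.rootCoord j = u.rootCoord j - k * deltaCoord j + if j = i then 1 else 0 := by
  decide +kernel

theorem lower_range : ∀ (i : Fin 6) (v : Weight), ∀ p ∈ lower i v, p.2 = 0 ∨ p.2 = 1 := by
  decide +kernel

theorem step_of_lower {i : Fin 6} {v u : Weight} {k : ℤ} (h : lower i v = some (u, k)) (s : ℤ) :
    Step i ⟨u, s - k⟩ ⟨v, s⟩ := by
  intro j
  have hk : ∃ k' : Fin 2, (k' : ℤ) = k := by
    rcases lower_range i v _ h with h | h
    · exact ⟨0, h.symm⟩
    · exact ⟨1, h.symm⟩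
  obtain ⟨k', rfl⟩ := hk
  have := lower_spec i v u k' h j
  simp only [rootCoord, this]
  ring

theorem Step.unique_right {i : Fin 6} {a b c : AffWeight} (h : Step i a b) (h' : Step i a c) :
    b = c :=
  rootCoord_injective fun j => by have := h j; have := h' j; lia

theorem Step.ht_eq {i : Fin 6} {a b : AffWeight} (h : Step i a b) : ht b = ht a + 1 := by
  simp only [ht_eq_sum_rootCoord]
  rw [Finset.sum_congr rfl fun j _ => h j, Finset.sum_add_distrib]
  simp

theorem arrow_of_lower {i : Fin 6} {v u : Weight} {k : ℤ} (h : lower i v = some (u, k)) (s : ℤ) :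
    Arrow ⟨u, s⟩ ⟨v, s + k⟩ := by
  fin_cases i <;> cases v <;> simp only [lower, Option.some.injEq, Prod.mk.injEq, reduceCtorEq]
    at h <;> obtain ⟨rfl, rfl⟩ := h <;> (try rw [add_zero]) <;> constructor

theorem Arrow.exists_lower {a b : AffWeight} (h : Arrow a b) :
    ∃ i, lower i b.weight = some (a.weight, b.level - a.level) := by
  cases h
  case a01 | a11 | a15 | a18 => exact ⟨5, by simp [lower]⟩
  case a03 | a06 | a10 | a20 => exact ⟨1, by simp [lower]⟩
  case a02 | a08 | a13 | a19 => exact ⟨2, by simp [lower]⟩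
  case a04 | a05 | a16 | a17 => exact ⟨3, by simp [lower]⟩
  case a07 | a09 | a12 | a14 => exact ⟨4, by simp [lower]⟩
  all_goals exact ⟨0, by simp [lower]⟩

theorem Arrow.exists_step {a b : AffWeight} (h : Arrow a b) : ∃ i, Step i a b := by
  obtain ⟨i, hi⟩ := h.exists_lower
  exact ⟨i, by simpa using step_of_lower hi b.level⟩

/-! ### The path order as the coordinatewise order -/

theorem rootCoord_mono {a b : AffWeight} (h : a ≤ b) (i : Fin 6) :
    rootCoord a i ≤ rootCoord b i := by
  induction (show Relation.ReflTransGen Arrow a b from h) with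
  | refl => exact le_rfl
  | tail _ hbc ih =>
    obtain ⟨j, hj⟩ := hbc.exists_step
    have := hj i
    have := ih (show a ≤ _ by assumption)
    split_ifs at * <;> omega

/-- The finite check behind `exists_arrow_step`: below a coordinatewise bound there is always an
upward edge that respects it. The level shift of the edge is spelled out as `0` or `1` to keep the
statement decidable. -/
theorem exists_lower_of_rootCoord_le : ∀ (k : Fin 3) (u v : Weight),
    (∀ i, u.rootCoord i ≤ v.rootCoord i + k * deltaCoord i) → (u ≠ v ∨ k ≠ 0) →
    ∃ i, u.rootCoord i < v.rootCoord i + k * deltaCoord i ∧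
      ∃ w, lower i w = some (u, 0) ∨ lower i w = some (u, 1) := by
  decide +kernel

theorem exists_lower_eq :
    ∀ u : Weight, ∃ i w, lower i w = some (u, 0) ∨ lower i w = some (u, 1) := by
  decide +kernel

theorem level_le_of_rootCoord_le {a b : AffWeight} (h : ∀ i, rootCoord a i ≤ rootCoord b i) :
    a.level ≤ b.level := by
  simpa [rootCoord_zero] using h 0

theorem exists_arrow_step {a b : AffWeight} (hab : ∀ i, rootCoord a i ≤ rootCoord b i)
    (hne : a ≠ b) : ∃ i c, Arrow a c ∧ Step i a c ∧ ∀ i, rootCoord c i ≤ rootCoord b i := by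
  have key : ∃ i, rootCoord a i < rootCoord b i ∧
      ∃ w, lower i w = some (a.weight, 0) ∨ lower i w = some (a.weight, 1) := by
    rcases le_or_gt (a.level + 3) b.level with h | h
    · obtain ⟨i, hi⟩ := exists_lower_eq a.weight
      exact ⟨i, rootCoord_lt_of_level h i, hi⟩
    · have h0 := level_le_of_rootCoord_le hab
      obtain ⟨k, hk⟩ : ∃ k : Fin 3, (k : ℤ) = b.level - a.level :=
        ⟨⟨(b.level - a.level).toNat, by lia⟩, by simp; lia⟩
      have hb : b.level = a.level + k := by lia
      obtain ⟨i, hi, w⟩ := exists_lower_of_rootCoord_le k a.weight b.weight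
        (fun i => by have := hab i; simp only [rootCoord, hb] at this; linarith) (by
          by_contra! hc
          refine hne (AffWeight.ext hc.1 ?_)
          rw [hb, hc.2]
          simp)
      refine ⟨i, ?_, w⟩
      simp only [rootCoord, hb]
      linarith
  obtain ⟨i, hi, w, hw⟩ := key
  obtain ⟨k, hw⟩ : ∃ k, lower i w = some (a.weight, k) := by
    rcases hw with hw | hw
    exacts [⟨_, hw⟩, ⟨_, hw⟩]
  have hs := step_of_lower hw (a.level + k)
  rw [add_sub_cancel_right] at hs
  refine ⟨i, _, arrow_of_lower hw a.level, hs, fun j => ?_⟩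
  have h1 := hs j
  have h2 := hab j
  split_ifs at h1 with h
  · subst h
    exact h1.trans_le hi
  · exact (h1.trans (add_zero _)).trans_le h2

theorem le_iff_rootCoord_le {a b : AffWeight} :
    a ≤ b ↔ ∀ i, rootCoord a i ≤ rootCoord b i := by
  refine ⟨rootCoord_mono, fun h => ?_⟩
  -- Height is the sum of the coordinates, so climbing along edges that stay coordinatewise below
  -- `b` must end at `b`; the induction is on the remaining height.
  obtain ⟨n, hn⟩ : ∃ n : ℕ, ht b - ht a ≤ n := ⟨(ht b - ht a).toNat, by lia⟩
  induction n generalizing a with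
  | zero =>
    by_contra hab
    obtain ⟨i, c, hac, hs, hcb⟩ := exists_arrow_step h (by rintro rfl; exact hab le_rfl)
    have h1 := hs.ht_eq
    have h2 : ht c ≤ ht b := by
      simp only [ht_eq_sum_rootCoord]
      exact Finset.sum_le_sum fun i _ => hcb i
    lia
  | succ n ih =>
    by_cases hne : a = b
    · exact hne.le
    obtain ⟨i, c, hac, hs, hcb⟩ := exists_arrow_step h hne
    exact (Relation.ReflTransGen.single hac : a ≤ c).trans (ih hcb (by have := hs.ht_eq; lia))

theorem Step.le {i : Fin 6} {a b : AffWeight} (h : Step i a b) : a ≤ b :=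
  le_iff_rootCoord_le.2 fun j => by have := h j; split_ifs at this <;> lia

theorem Step.arrow {i : Fin 6} {a b : AffWeight} (h : Step i a b) : Arrow a b := by
  obtain ⟨j, c, hac, hs, hcb⟩ := exists_arrow_step (le_iff_rootCoord_le.1 h.le)
    (by rintro rfl; have := h.ht_eq; lia)
  have hij : j = i := by
    by_contra hij
    have h1 := hs j
    have h2 := hcb j
    have h3 := h j
    simp [hij] at h1 h3
    lia
  subst hij
  rwa [h.unique_right hs]

theorem Step.lower_eq {i : Fin 6} {a b : AffWeight} (h : Step i a b) :
    lower i b.weight = some (a.weight, b.level - a.level) := by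
  obtain ⟨j, hj⟩ := h.arrow.exists_lower
  have hs := step_of_lower hj b.level
  rw [sub_sub_cancel] at hs
  have hij : i = j := by
    by_contra hij
    have h1 := hs j
    have h3 := h j
    simp [Ne.symm hij] at h1 h3
    exact absurd (h3.symm.trans h1) (by lia)
  rw [hij, hj]

theorem exists_lower_of_rootCoord_eq : ∀ (k : Fin 3) (i : Fin 6) (u v : Weight),
    lower i v ≠ none → (∀ i, u.rootCoord i ≤ v.rootCoord i + k * deltaCoord i) →
    u.rootCoord i = v.rootCoord i + k * deltaCoord i → lower i u ≠ none := by
  decide +kernel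

/-- If `d` covers `c` by an edge with label `i`, then every element below `d` but not below `c` is
the target of an edge with label `i`. -/
theorem Step.exists_step_of_le {i : Fin 6} {c d a : AffWeight} (h : Step i c d) (had : a ≤ d)
    (hac : ¬ a ≤ c) : ∃ b, Step i b a := by
  have hle := le_iff_rootCoord_le.1 had
  have heq : rootCoord a i = rootCoord d i := by
    by_contra hne
    refine hac (le_iff_rootCoord_le.2 fun j => ?_)
    have h1 := h j
    have h2 := hle j
    split_ifs at h1 with hj
    · subst hj; lia
    · lia
  have h0 := level_le_of_rootCoord_le hle
  have h3 : d.level < a.level + 3 := by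
    by_contra! h3
    exact (rootCoord_lt_of_level h3 i).ne heq
  obtain ⟨k, hk⟩ : ∃ k : Fin 3, (k : ℤ) = d.level - a.level :=
    ⟨⟨(d.level - a.level).toNat, by lia⟩, by simp; lia⟩
  have hb : d.level = a.level + k := by lia
  have := exists_lower_of_rootCoord_eq k i a.weight d.weight (by simp [h.lower_eq])
    (fun j => by have := hle j; simp only [rootCoord, hb] at this; linarith)
    (by simp only [rootCoord, hb] at heq; linarith)
  obtain ⟨⟨u, m⟩, hu⟩ := Option.ne_none_iff_exists'.1 this
  exact ⟨_, step_of_lower hu a.level⟩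

/-- Two edges with different labels leaving the same weight complete to a square; this produces the
join in `covers_of_lt`. -/
theorem exists_lower_lower : ∀ (i j : Fin 6) (v w : Weight), i ≠ j →
    ∀ p ∈ lower i v, ∀ q ∈ lower j w, p.1 = q.1 → ∃ x, lower j x = some (v, q.2) := by
  decide +kernel

/-- The labels of the edges that start at a weight, possibly with repetition. -/
def upLabels : Weight → Fin 6 × Fin 6
  | .e0 => (5, 5)
  | .w12 => (2, 2)
  | .w13 => (1, 3)
  | .w14 => (1, 4)
  | .w23 => (3, 3)
  | .w15 => (1, 1)
  | .w24 => (2, 4)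
  | .w25 => (2, 2)
  | .w34 => (4, 5)
  | .w35 => (3, 5)
  | .p5 => (4, 4)
  | .w45 => (0, 5)
  | .p4 => (3, 3)
  | .p3 => (0, 2)
  | .p2 => (0, 1)
  | .p1 => (0, 0)

theorem label_mem_upLabels : ∀ (i : Fin 6) (v : Weight), ∀ p ∈ lower i v,
    i = (upLabels p.1).1 ∨ i = (upLabels p.1).2 := by
  decide +kernel

theorem Step.exists_square {i j : Fin 6} {a b c : AffWeight} (hij : i ≠ j) (hb : Step i a b)
    (hc : Step j a c) : ∃ d, Step j b d ∧ Step i c d := by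
  obtain ⟨x, hx⟩ := exists_lower_lower i j _ _ hij _ hb.lower_eq _ hc.lower_eq rfl
  have hs := step_of_lower hx (b.level + (c.level - a.level))
  rw [add_sub_cancel_right] at hs
  refine ⟨_, hs, fun m => ?_⟩
  have h1 := hs m
  have h2 := hb m
  have h3 := hc m
  change rootCoord _ m = rootCoord b m + _ at h1
  lia

theorem Step.label_eq {i j k : Fin 6} {a b c d : AffWeight} (hij : i ≠ j) (hb : Step i a b)
    (hc : Step j a c) (hd : Step k a d) : k = i ∨ k = j := by
  have h1 := label_mem_upLabels i _ _ hb.lower_eq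
  have h2 := label_mem_upLabels j _ _ hc.lower_eq
  have h3 := label_mem_upLabels k _ _ hd.lower_eq
  simp only at h1 h2 h3
  grind

/-- The structure of an interval just above its bottom element. -/
theorem covers_of_lt {a d : AffWeight} (h : a < d) :
    (∃ b, ht b = ht a + 1 ∧ a < b ∧ b ≤ d ∧ ∀ x, a < x → x ≤ d → b ≤ x) ∨
    ∃ b c e, ht b = ht a + 1 ∧ ht c = ht a + 1 ∧ ht e = ht a + 2 ∧ a < b ∧ a < c ∧
      b ≤ d ∧ c ≤ d ∧ e ≤ d ∧
      (∀ x, a < x → b ≤ x ∨ c ≤ x) ∧ ∀ x, b ≤ x ∧ c ≤ x ↔ e ≤ x := by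
  have hlt : ∀ {i : Fin 6} {a b : AffWeight}, Step i a b → a < b := fun hs =>
    lt_of_le_of_ne hs.le (by rintro rfl; have := hs.ht_eq; lia)
  have key : ∀ x, a < x → ∃ i c, Step i a c ∧ c ≤ x := fun x hx => by
    obtain ⟨i, c, -, hs, hc⟩ := exists_arrow_step (rootCoord_mono hx.le) hx.ne
    exact ⟨i, c, hs, le_iff_rootCoord_le.2 hc⟩
  obtain ⟨i, b, hb, hbd⟩ := key d h
  by_cases hex : ∃ j c, Step j a c ∧ c ≤ d ∧ i ≠ j
  · obtain ⟨j, c, hc, hcd, hij⟩ := hex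
    obtain ⟨e, hbe, hce⟩ := Step.exists_square hij hb hc
    -- As `i ≠ j`, the fourth vertex `e` of the square is the coordinatewise maximum of `b` and `c`.
    have hjoin : ∀ x, b ≤ x ∧ c ≤ x ↔ e ≤ x := fun x => by
      refine ⟨fun ⟨h1, h2⟩ => le_iff_rootCoord_le.2 fun m => ?_,
        fun h => ⟨hbe.le.trans h, hce.le.trans h⟩⟩
      have h1 := rootCoord_mono h1 m
      have h2 := rootCoord_mono h2 m
      have h3 := hbe m
      have h4 := hb m
      have h5 := hc m
      by_cases hmj : m = j
      · subst hmj
        simp [hij.symm] at h3 h4 h5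
        lia
      · simp [hmj] at h3
        lia
    have h1 := hb.ht_eq
    have h2 := hc.ht_eq
    have h3 := hbe.ht_eq
    refine Or.inr ⟨b, c, e, h1, h2, by lia, hlt hb, hlt hc, hbd, hcd, (hjoin d).1 ⟨hbd, hcd⟩,
      fun x hx => ?_, hjoin⟩
    obtain ⟨k, y, hy, hyx⟩ := key x hx
    rcases Step.label_eq hij hb hc hy with rfl | rfl
    · exact Or.inl (by rwa [hb.unique_right hy])
    · exact Or.inr (by rwa [hc.unique_right hy])
  · push Not at hex
    refine Or.inl ⟨b, hb.ht_eq, hlt hb, hbd, fun x hx hxd => ?_⟩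
    obtain ⟨k, y, hy, hyx⟩ := key x hx
    obtain rfl := hex k y hy (hyx.trans hxd)
    rwa [hb.unique_right hy]

/-! ### The terms of the quadratic forms -/

/-- The pairs of coordinates that occur in a quadratic form. -/
def quadPair : VecIndex → Fin 4 → Weight × Weight
  | .v1 => ![(.e0, .p1), (.w25, .w34), (.w24, .w35), (.w23, .w45)]
  | .v2 => ![(.e0, .p2), (.w15, .w34), (.w14, .w35), (.w13, .w45)]
  | .v3 => ![(.e0, .p3), (.w15, .w24), (.w14, .w25), (.w12, .w45)]
  | .v4 => ![(.e0, .p4), (.w15, .w23), (.w13, .w25), (.w12, .w35)]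
  | .v5 => ![(.e0, .p5), (.w14, .w23), (.w13, .w24), (.w12, .w34)]
  | .v1s => ![(.p2, .w12), (.p3, .w13), (.p4, .w14), (.p5, .w15)]
  | .v2s => ![(.p1, .w12), (.p3, .w23), (.p4, .w24), (.p5, .w25)]
  | .v3s => ![(.p1, .w13), (.p2, .w23), (.p4, .w34), (.p5, .w35)]
  | .v4s => ![(.p1, .w14), (.p2, .w24), (.p3, .w34), (.p5, .w45)]
  | .v5s => ![(.p1, .w15), (.p2, .w25), (.p3, .w35), (.p4, .w45)]

/-- The signs of the terms of a quadratic form. -/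
def quadSign : VecIndex → Fin 4 → ℤ
  | .v1 => ![1, 1, -1, 1]
  | .v2 => ![-1, -1, 1, -1]
  | .v3 => ![1, 1, -1, 1]
  | .v4 => ![-1, -1, 1, -1]
  | .v5 => ![1, 1, -1, 1]
  | _ => ![-1, 1, -1, 1]

theorem Gam_eq_sum {R : Type*} [CommRing R] (s : VecIndex) (x : Weight → R) :
    Gam s x = ∑ j, (quadSign s j : R) * (x (quadPair s j).1 * x (quadPair s j).2) := by
  cases s <;> simp [Gam, quadPair, quadSign, Fin.sum_univ_four] <;> ring

theorem isUnit_quadSign (s : VecIndex) (j : Fin 4) : quadSign s j = 1 ∨ quadSign s j = -1 := by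
  cases s <;> fin_cases j <;> simp [quadSign]

/-- The pair of weights `u`, `v` with level difference `k` is the only one with the smallest
height gap among the terms of a coefficient of `Γ^s`. -/
def IsClosestPair (k : ℤ) (u v : Weight) (s : VecIndex) : Prop :=
  (∃ j, quadPair s j = (u, v) ∨ quadPair s j = (v, u)) ∧
    ∀ (j : Fin 4) (e : Fin 9), ((e : ℤ) - 4) % 2 = k % 2 →
      (quadPair s j = (u, v) ∧ (e : ℤ) - 4 = k) ∨ (quadPair s j = (v, u) ∧ (e : ℤ) - 4 = -k) ∨
      |8 * k + v.ht - u.ht| < |8 * ((e : ℤ) - 4) + (quadPair s j).2.ht - (quadPair s j).1.ht|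

instance (k : ℤ) (u v : Weight) (s : VecIndex) : Decidable (IsClosestPair k u v s) := by
  unfold IsClosestPair
  infer_instance

/-- The two hypotheses say that the pair is incomparable at level difference `k - 2`. The competing
level differences `e - 4` have the same parity, because the sum of the two levels is fixed in a
coefficient of `Γ^s`. -/
theorem exists_isClosestPair : ∀ (k : Fin 5) (u v : Weight),
    (∃ i, v.rootCoord i + ((k : ℤ) - 2) * deltaCoord i < u.rootCoord i) →
    (∃ i, u.rootCoord i < v.rootCoord i + ((k : ℤ) - 2) * deltaCoord i) →
    |8 * ((k : ℤ) - 2) + v.ht - u.ht| ≤ 2 ∧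
    ∃ s ∈ [VecIndex.v1, .v2, .v3, .v4, .v5, .v1s, .v2s, .v3s, .v4s, .v5s],
      IsClosestPair ((k : ℤ) - 2) u v s := by
  decide +kernel

theorem quadPair_ht_add (s : VecIndex) (i j : Fin 4) :
    (quadPair s i).1.ht + (quadPair s i).2.ht = (quadPair s j).1.ht + (quadPair s j).2.ht := by
  cases s <;> revert i j <;> decide

theorem Weight.ht_mem (u : Weight) : 0 ≤ u.ht ∧ u.ht ≤ 10 := by
  cases u <;> decide

/-- Every incomparable pair is the pair with the smallest height gap in exactly one relation. -/
theorem exists_quadPair_of_incomparable {a b : AffWeight} (hab : ¬ a ≤ b) (hba : ¬ b ≤ a) :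
    ∃ s j, (quadPair s j = (a.weight, b.weight) ∨ quadPair s j = (b.weight, a.weight)) ∧
      ∀ j' (x y : AffWeight), quadPair s j' = (x.weight, y.weight) →
        x.level + y.level = a.level + b.level →
        (x = a ∧ y = b) ∨ (x = b ∧ y = a) ∨
          ht x ^ 2 + ht y ^ 2 > ht a ^ 2 + ht b ^ 2 := by
  have hab' := hab
  have hba' := hba
  simp only [le_iff_rootCoord_le, not_forall, not_le] at hab hba
  have h1 : b.level < a.level + 3 := by
    by_contra! h
    exact hab' (le_iff_rootCoord_le.2 fun i => (rootCoord_lt_of_level h i).le)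
  have h2 : a.level < b.level + 3 := by
    by_contra! h
    exact hba' (le_iff_rootCoord_le.2 fun i => (rootCoord_lt_of_level h i).le)
  obtain ⟨k, hk⟩ : ∃ k : Fin 5, (k : ℤ) - 2 = b.level - a.level :=
    ⟨⟨(b.level - a.level + 2).toNat, by lia⟩, by simp; lia⟩
  have hb : b.level = a.level + ((k : ℤ) - 2) := by lia
  obtain ⟨h3, s, -, ⟨j, hj⟩, h4⟩ := exists_isClosestPair k a.weight b.weight
    (by obtain ⟨i, hi⟩ := hab; refine ⟨i, ?_⟩; simp only [rootCoord, hb] at hi; linarith)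
    (by obtain ⟨i, hi⟩ := hba; refine ⟨i, ?_⟩; simp only [rootCoord, hb] at hi; linarith)
  refine ⟨s, j, hj, fun j' x y hxy hl => ?_⟩
  -- All terms of one coefficient have the same total height, so a larger gap is the same as a
  -- larger sum of squares of heights.
  have hsum : ∀ {g h : ℤ}, |g| < |h| → ∀ {p q r t : ℤ}, p - q = g → r - t = h →
      p + q = r + t → p ^ 2 + q ^ 2 < r ^ 2 + t ^ 2 := by
    intro g h hgh p q r t h1 h2 h3
    have h5 := sq_lt_sq.2 hgh
    subst h1 h2
    nlinarith [congrArg (fun z => z ^ 2) h3]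
  have h10 := Weight.ht_mem a.weight
  have h11 := Weight.ht_mem b.weight
  have h12 := Weight.ht_mem x.weight
  have h13 := Weight.ht_mem y.weight
  have hbal := quadPair_ht_add s j' j
  simp only [hxy] at hbal
  have hbal' : x.weight.ht + y.weight.ht = a.weight.ht + b.weight.ht := by
    rcases hj with hj | hj <;> simp only [hj] at hbal <;> lia
  have concl : |8 * ((k : ℤ) - 2) + b.weight.ht - a.weight.ht| <
      |8 * (y.level - x.level) + y.weight.ht - x.weight.ht| →
      ht x ^ 2 + ht y ^ 2 > ht a ^ 2 + ht b ^ 2 := fun h => by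
    have := hsum h (p := ht b) (q := ht a) (r := ht y) (t := ht x)
      (by simp only [ht]; lia) (by simp only [ht]; lia) (by simp only [ht]; lia)
    lia
  -- Outside this range the height gap is at least `8 * 5 - 10`, whereas the gap of an incomparable
  -- pair is at most two.
  by_cases he : -4 ≤ y.level - x.level ∧ y.level - x.level ≤ 4
  · obtain ⟨e, he⟩ : ∃ e : Fin 9, (e : ℤ) - 4 = y.level - x.level :=
      ⟨⟨(y.level - x.level + 4).toNat, by lia⟩, by simp; lia⟩
    have h5 := h4 j' e (by lia)
    rw [hxy] at h5
    simp only [Prod.mk.injEq] at h5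
    rcases h5 with ⟨⟨h5, h6⟩, h7⟩ | ⟨⟨h5, h6⟩, h7⟩ | h5
    · exact Or.inl ⟨AffWeight.ext h5 (by lia), AffWeight.ext h6 (by lia)⟩
    · exact Or.inr (Or.inl ⟨AffWeight.ext h5 (by lia), AffWeight.ext h6 (by lia)⟩)
    · exact Or.inr (Or.inr (concl (by rw [← he]; exact h5)))
  · exact Or.inr (Or.inr (concl (h3.trans_lt (by rw [lt_abs]; lia))))

/-! ### Straightening -/

theorem quadPair_fst_inj (s : VecIndex) {i j : Fin 4}
    (h : (quadPair s i).1 = (quadPair s j).1) : i = j := by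
  cases s <;> revert i j <;> decide

theorem quadPair_fst_ne_snd (s : VecIndex) (i j : Fin 4) :
    (quadPair s i).1 ≠ (quadPair s j).2 := by
  cases s <;> revert i j <;> decide

/-- In each form the first and the second entries of the pairs are disjoint sets of weights, so only
one orientation `(p, q)` of the pair occurs, and in only one term. No cancellation or doubling of
`λ^a λ^b` is therefore possible. -/
theorem exists_quadPair_unique {a b : AffWeight} (hab : ¬ a ≤ b) (hba : ¬ b ≤ a) :
    ∃ s j p q, (p = a ∧ q = b ∨ p = b ∧ q = a) ∧ quadPair s j = (p.weight, q.weight) ∧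
      ∀ j' (x y : AffWeight), quadPair s j' = (x.weight, y.weight) →
        x.level + y.level = a.level + b.level →
        (j' = j ∧ x = p ∧ y = q) ∨ ht x ^ 2 + ht y ^ 2 > ht a ^ 2 + ht b ^ 2 := by
  have main : ∀ (s j) (a b p q : AffWeight), (p = a ∧ q = b ∨ p = b ∧ q = a) →
      quadPair s j = (p.weight, q.weight) →
      (∀ j' (x y : AffWeight), quadPair s j' = (x.weight, y.weight) →
        x.level + y.level = a.level + b.level →
        (x = a ∧ y = b) ∨ (x = b ∧ y = a) ∨ ht x ^ 2 + ht y ^ 2 > ht a ^ 2 + ht b ^ 2) →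
      ∀ j' (x y : AffWeight), quadPair s j' = (x.weight, y.weight) →
        x.level + y.level = a.level + b.level →
        (j' = j ∧ x = p ∧ y = q) ∨ ht x ^ 2 + ht y ^ 2 > ht a ^ 2 + ht b ^ 2 := by
    intro s j a b p q hpq hj h j' x y hxy hl
    have h1 : (x = p ∧ y = q) ∨ (x = q ∧ y = p) ∨ ht x ^ 2 + ht y ^ 2 > ht a ^ 2 + ht b ^ 2 := by
      have := h j' x y hxy hl
      rcases hpq with ⟨rfl, rfl⟩ | ⟨rfl, rfl⟩
      · exact this
      · tauto
    rcases h1 with ⟨rfl, rfl⟩ | ⟨rfl, rfl⟩ | h1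
    · exact Or.inl ⟨quadPair_fst_inj s (by rw [hxy, hj]), rfl, rfl⟩
    · exact absurd (by rw [hxy, hj]) (quadPair_fst_ne_snd s j' j)
    · exact Or.inr h1
  obtain ⟨s, j, hj | hj, h⟩ := exists_quadPair_of_incomparable hab hba
  · exact ⟨s, j, a, b, Or.inl ⟨rfl, rfl⟩, hj, main s j a b a b (Or.inl ⟨rfl, rfl⟩) hj h⟩
  · exact ⟨s, j, b, a, Or.inr ⟨rfl, rfl⟩, hj, main s j a b b a (Or.inr ⟨rfl, rfl⟩) hj h⟩

open MvPolynomial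

variable {d d' : AffWeight}

theorem coeff_genFun_mul_genFun (α β : Weight) (l : ℤ) :
    (genFun d d' α * genFun d d' β).coeff l =
      ∑ a : Set.Icc d d', ∑ b : Set.Icc d d',
        if a.1.weight = α ∧ b.1.weight = β ∧ a.1.level + b.1.level = l then
          (X a * X b : Poly d d') else 0 := by
  classical
  have h : ∀ a b : Set.Icc d d', (if a.1.weight = α then LaurentPolynomial.C (X a : Poly d d') *
        LaurentPolynomial.T a.1.level else 0) * (if b.1.weight = β then
        LaurentPolynomial.C (X b : Poly d d') * LaurentPolynomial.T b.1.level else 0) =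
      if a.1.weight = α ∧ b.1.weight = β then
        LaurentPolynomial.C (X a * X b : Poly d d') *
        LaurentPolynomial.T (a.1.level + b.1.level) else 0 := by
    intro a b
    by_cases ha : a.1.weight = α <;> by_cases hb : b.1.weight = β <;> simp [ha, hb]
    rw [LaurentPolynomial.T_add]
    ring
  simp only [genFun, Finset.sum_mul_sum, h, AddMonoidAlgebra.coeff_sum, Finsupp.finsetSum_apply]
  refine Finset.sum_congr rfl fun a _ => Finset.sum_congr rfl fun b _ => ?_
  by_cases hab : a.1.weight = α ∧ b.1.weight = β
  · rw [if_pos hab, ← LaurentPolynomial.single_eq_C_mul_T, AddMonoidAlgebra.coeff_single,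
      Finsupp.single_apply]
    simp [hab]
  · rw [if_neg hab, if_neg (by tauto)]
    simp

theorem rel_eq_sum (s : VecIndex) (l : ℤ) :
    rel d d' s l = ∑ t : Fin 4 × Set.Icc d d' × Set.Icc d d',
      if quadPair s t.1 = (t.2.1.1.weight, t.2.2.1.weight) ∧
          t.2.1.1.level + t.2.2.1.level = l then
        (quadSign s t.1 : Poly d d') * (X t.2.1 * X t.2.2) else 0 := by
  have hs : ∀ (j : Fin 4) (f : LaurentPolynomial (Poly d d')),
      (((quadSign s j : ℤ) : LaurentPolynomial (Poly d d')) * f).coeff l =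
        (quadSign s j : Poly d d') * f.coeff l := by
    intro j f
    rw [← zsmul_eq_mul, ← zsmul_eq_mul]
    rfl
  rw [rel, Gam_eq_sum, AddMonoidAlgebra.coeff_sum, Finsupp.finsetSum_apply,
    Fintype.sum_prod_type]
  refine Finset.sum_congr rfl fun j _ => ?_
  rw [hs, coeff_genFun_mul_genFun, Fintype.sum_prod_type, Finset.mul_sum]
  refine Finset.sum_congr rfl fun a _ => ?_
  rw [Finset.mul_sum]
  refine Finset.sum_congr rfl fun b _ => ?_
  rw [mul_ite, mul_zero]
  refine if_congr ?_ rfl rfl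
  rw [Prod.ext_iff, and_assoc, eq_comm, eq_comm (a := b.1.weight)]

/-- The distinguished term of the relation has coefficient `1` or `-1`, so the relation can be
solved for it; terms with a variable outside the interval are simply absent. -/
theorem X_mul_X_mem {a b : Set.Icc d d'} (hab : ¬ a ≤ b) (hba : ¬ b ≤ a) :
    (X a * X b : Poly d d') ∈ (relIdeal d d').restrictScalars ℂ ⊔
      Submodule.span ℂ {f | ∃ x y : Set.Icc d d',
        ht x ^ 2 + ht y ^ 2 > ht a ^ 2 + ht b ^ 2 ∧ f = X x * X y} := by
  classical
  obtain ⟨s, j, p, q, hpq, hj, h⟩ := exists_quadPair_unique (a := a.1) (b := b.1) hab hba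
  obtain ⟨p', q', rfl, rfl, hX, hl⟩ : ∃ p' q' : Set.Icc d d', p = p' ∧ q = q' ∧
      (X p' * X q' : Poly d d') = X a * X b ∧ p'.1.level + q'.1.level = a.1.level + b.1.level := by
    rcases hpq with ⟨rfl, rfl⟩ | ⟨rfl, rfl⟩
    · exact ⟨a, b, rfl, rfl, rfl, rfl⟩
    · exact ⟨b, a, rfl, rfl, mul_comm _ _, add_comm _ _⟩
  have hrel := rel_eq_sum (d := d) (d' := d') s (a.1.level + b.1.level)
  rw [← Finset.add_sum_erase _ _ (Finset.mem_univ (j, p', q')), if_pos ⟨hj, hl⟩] at hrel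
  dsimp only at hrel
  rw [hX] at hrel
  have hmem : rel d d' s (a.1.level + b.1.level) ∈ (relIdeal d d').restrictScalars ℂ :=
    Ideal.subset_span ⟨(s, _), rfl⟩
  have hsign : ∀ (i : Fin 4) (f : Poly d d') (N : Submodule ℂ (Poly d d')), f ∈ N →
      (quadSign s i : Poly d d') * f ∈ N := by
    intro i f N hf
    rcases isUnit_quadSign s i with h | h <;> simp [h, hf]
  have hrN : rel d d' s (a.1.level + b.1.level) - (quadSign s j : Poly d d') * (X a * X b) ∈
      Submodule.span ℂ {f | ∃ x y : Set.Icc d d',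
        ht x ^ 2 + ht y ^ 2 > ht a ^ 2 + ht b ^ 2 ∧ f = X x * X y} := by
    rw [hrel, add_sub_cancel_left]
    refine Submodule.sum_mem _ fun t ht => ?_
    split_ifs with hc
    · refine hsign _ _ _ (Submodule.subset_span ⟨t.2.1, t.2.2, ?_, rfl⟩)
      refine (h t.1 t.2.1 t.2.2 hc.1 hc.2).resolve_left fun ⟨h1, h2, h3⟩ => ?_
      exact (Finset.mem_erase.1 ht).1 (Prod.ext h1 (Prod.ext (Subtype.ext h2) (Subtype.ext h3)))
    · exact zero_mem _
  have hX' : (X a * X b : Poly d d') = (quadSign s j : Poly d d') *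
      (rel d d' s (a.1.level + b.1.level) - (rel d d' s (a.1.level + b.1.level) -
        (quadSign s j : Poly d d') * (X a * X b))) := by
    rcases isUnit_quadSign s j with h | h <;> simp [h]
  rw [hX']
  exact hsign _ _ _ (sub_mem (Submodule.mem_sup_left hmem) (Submodule.mem_sup_right hrN))

/-- The polynomials all of whose monomials are standard, i.e. supported on chains. -/
def stdSubmodule (σ : Type*) [LE σ] : Submodule ℂ (MvPolynomial σ ℂ) where
  carrier := {p | ∀ s ∈ p.support, IsChain (· ≤ ·) (s.support : Set σ)}
  zero_mem' := by simp
  add_mem' hp hq s hs := by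
    classical
    rcases Finset.mem_union.1 (support_add hs) with h | h
    exacts [hp s h, hq s h]
  smul_mem' c p hp s hs := hp s (support_smul hs)

theorem monomial_mem_stdSubmodule {σ : Type*} [LE σ] {s : σ →₀ ℕ} (c : ℂ)
    (hs : IsChain (· ≤ ·) (s.support : Set σ)) : monomial s c ∈ stdSubmodule σ := fun t ht => by
  rwa [Finset.mem_singleton.1 (support_monomial_subset ht)]

theorem monomial_mem_sup (s : Set.Icc d d' →₀ ℕ) :
    (monomial s 1 : Poly d d') ∈ (relIdeal d d').restrictScalars ℂ ⊔ stdSubmodule _ := by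
  classical
  -- Straightening raises the sum of squared heights at constant degree. Subtracting each square
  -- from the common bound `M` gives a natural-number weight that drops, and no truncation occurs in
  -- `toNat`.
  obtain ⟨M, hM⟩ : ∃ M : ℤ, ∀ x : Set.Icc d d', ht x.1 ^ 2 ≤ M := by
    obtain ⟨M, hM⟩ := (Set.finite_range fun x : Set.Icc d d' => ht x.1 ^ 2).bddAbove
    exact ⟨M, fun x => hM ⟨x, rfl⟩⟩
  set w : Set.Icc d d' → ℕ := fun x => (M - ht x.1 ^ 2).toNat with hw
  induction h : Finsupp.weight w s using Nat.strong_induction_on generalizing s with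
  | _ n ih =>
    by_cases hs : IsChain (· ≤ ·) (s.support : Set (Set.Icc d d'))
    · exact Submodule.mem_sup_right (monomial_mem_stdSubmodule 1 hs)
    have hs' : ∃ a ∈ s.support, ∃ b ∈ s.support, ¬ a ≤ b ∧ ¬ b ≤ a := by
      by_contra! hc
      exact hs fun a ha b hb _ => or_iff_not_imp_left.2 (hc a ha b hb)
    obtain ⟨a, ha, b, hb, hab, hba⟩ := hs'
    have hne : a ≠ b := by rintro rfl; exact hab le_rfl
    obtain ⟨t, rfl⟩ : ∃ t, s = t + (Finsupp.single a 1 + Finsupp.single b 1) := by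
      refine ⟨s - (Finsupp.single a 1 + Finsupp.single b 1), (tsub_add_cancel_of_le ?_).symm⟩
      intro x
      rw [Finsupp.mem_support_iff] at ha hb
      simp only [Finsupp.add_apply, Finsupp.single_apply]
      split_ifs with h1 h2 h2
      · exact absurd (h1.trans h2.symm) hne
      · subst h1; lia
      · subst h2; lia
      · lia
    have hmul : ∀ x y : Set.Icc d d', (monomial (t + (Finsupp.single x 1 + Finsupp.single y 1)) 1 :
        Poly d d') = monomial t 1 * (X x * X y) := by
      intro x y
      simp [X, monomial_mul]
    rw [hmul]
    obtain ⟨r, hr, f, hf, hrf⟩ := Submodule.mem_sup.1 (X_mul_X_mem hab hba)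
    rw [← hrf, mul_add]
    refine add_mem (Submodule.mem_sup_left (Ideal.mul_mem_left _ _ hr)) ?_
    clear hrf
    induction hf using Submodule.span_induction with
    | mem f hf =>
      obtain ⟨x, y, hxy, rfl⟩ := hf
      rw [← hmul]
      refine ih _ ?_ _ rfl
      rw [← h]
      simp only [map_add, Finsupp.weight_single, hw]
      have := hM x
      have := hM y
      have := hM a
      have := hM b
      simp only [smul_eq_mul, one_mul]
      lia
    | zero => simp
    | add f g _ _ hf hg => rw [mul_add]; exact add_mem hf hg
    | smul c f _ hf => rw [mul_smul_comm]; exact Submodule.smul_mem _ _ hf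

/-- The standard monomials span the algebra. -/
theorem exists_std (p : Poly d d') : ∃ q ∈ stdSubmodule (Set.Icc d d'), p - q ∈ relIdeal d d' := by
  have : p ∈ (relIdeal d d').restrictScalars ℂ ⊔ stdSubmodule (Set.Icc d d') := by
    rw [p.as_sum]
    refine Submodule.sum_mem _ fun s _ => ?_
    rw [← mul_one (coeff s p), ← smul_eq_mul, ← smul_monomial]
    exact Submodule.smul_mem _ _ (monomial_mem_sup s)
  obtain ⟨r, hr, q, hq, rfl⟩ := Submodule.mem_sup.1 this
  exact ⟨q, hq, by simpa using hr⟩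

/-! ### Root subgroups -/

/-- The nonzero matrix coefficients of the simple root vectors are `1` or `-1`. -/
def actSign : Fin 6 → Weight → ℤ
  | 0, .e0 => -1
  | 5, .w12 => -1
  | _, _ => 1

/-- The action of the `i`-th simple root vector on spinors, where `c 1` is the loop parameter. -/
def lowerAct {R : Type*} [CommRing R] (i : Fin 6) (c : ℤ → R) (x : Weight → R) (α : Weight) : R :=
  match lower i α with
  | some p => (actSign i α : R) * (c p.2 * x p.1)
  | none => 0

theorem actSign_eq (i : Fin 6) (α : Weight) : actSign i α = 1 ∨ actSign i α = -1 := by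
  revert i α; decide

/-- The root subgroups preserve the space of the quadratic forms. -/
theorem Gam_add_lowerAct {R : Type*} [CommRing R] (i : Fin 6) (c : ℤ → R) (hc : c 0 = 1)
    (x : Weight → R) (τ : R) (s : VecIndex) :
    ∃ s' e, Gam s (fun α => x α + τ * lowerAct i c x α) = Gam s x + e * Gam s' x := by
  -- In the vector representation a simple root vector moves exactly two basis vectors; they give
  -- the two named cases. The other forms are invariant, and `.v1` with factor `0` is a dummy
  -- witness.
  fin_cases i
  · cases s
    case v4 => exact ⟨.v5s, τ * c 1, by simp [Gam, lowerAct, lower, actSign]; ring⟩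
    case v5 => exact ⟨.v4s, -(τ * c 1), by simp [Gam, lowerAct, lower, actSign]; ring⟩
    all_goals exact ⟨.v1, 0, by simp [Gam, lowerAct, lower, actSign]; try ring⟩
  · cases s
    case v1 => exact ⟨.v2, -τ, by simp [Gam, lowerAct, lower, actSign, hc]; ring⟩
    case v2s => exact ⟨.v1s, τ, by simp [Gam, lowerAct, lower, actSign, hc]; ring⟩
    all_goals exact ⟨.v1, 0, by simp [Gam, lowerAct, lower, actSign, hc]; try ring⟩
  · cases s
    case v2 => exact ⟨.v3, -τ, by simp [Gam, lowerAct, lower, actSign, hc]; ring⟩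
    case v3s => exact ⟨.v2s, τ, by simp [Gam, lowerAct, lower, actSign, hc]; ring⟩
    all_goals exact ⟨.v1, 0, by simp [Gam, lowerAct, lower, actSign, hc]; try ring⟩
  · cases s
    case v3 => exact ⟨.v4, -τ, by simp [Gam, lowerAct, lower, actSign, hc]; ring⟩
    case v4s => exact ⟨.v3s, τ, by simp [Gam, lowerAct, lower, actSign, hc]; ring⟩
    all_goals exact ⟨.v1, 0, by simp [Gam, lowerAct, lower, actSign, hc]; try ring⟩
  · cases s
    case v4 => exact ⟨.v5, -τ, by simp [Gam, lowerAct, lower, actSign, hc]; ring⟩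
    case v5s => exact ⟨.v4s, τ, by simp [Gam, lowerAct, lower, actSign, hc]; ring⟩
    all_goals exact ⟨.v1, 0, by simp [Gam, lowerAct, lower, actSign, hc]; try ring⟩
  · cases s
    case v1s => exact ⟨.v2, -τ, by simp [Gam, lowerAct, lower, actSign, hc]; ring⟩
    case v2s => exact ⟨.v1, τ, by simp [Gam, lowerAct, lower, actSign, hc]; ring⟩
    all_goals exact ⟨.v1, 0, by simp [Gam, lowerAct, lower, actSign, hc]; try ring⟩

theorem map_Gam {R S : Type*} [CommRing R] [CommRing S] (f : R →+* S) (s : VecIndex)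
    (x : Weight → R) : f (Gam s x) = Gam s fun α => f (x α) := by
  simp [Gam_eq_sum]

/-! ### Lowest coefficients -/

theorem coeff_aeval_monomial_of_le {σ τ : Type*} (β : σ → ℕ) (κ : σ → τ) (ε : σ → ℂ)
    (ψ : σ → Polynomial (MvPolynomial τ ℂ)) (hψ : ∀ a, (ψ a).coeff 0 = C (ε a) * X (κ a))
    (s : σ →₀ ℕ) (c : ℂ) {l : ℕ} (hl : l ≤ Finsupp.weight β s) :
    (aeval (fun a => Polynomial.X ^ β a * ψ a) (monomial s c)).coeff l =
      if Finsupp.weight β s = l then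
        monomial (s.mapDomain κ) (c * s.prod fun a n => ε a ^ n) else 0 := by
  have h1 : aeval (fun a => Polynomial.X ^ β a * ψ a) (monomial s c) =
      Polynomial.X ^ Finsupp.weight β s * (algebraMap ℂ _ c * s.prod fun a n => ψ a ^ n) := by
    rw [aeval_monomial, Finsupp.weight_apply]
    simp only [mul_pow, Finsupp.prod_mul, ← pow_mul, smul_eq_mul]
    rw [Finsupp.sum, ← Finset.prod_pow_eq_pow_sum]
    simp only [Finsupp.prod, mul_comm]
    ring
  have h2 : (algebraMap ℂ (Polynomial (MvPolynomial τ ℂ)) c * s.prod fun a n => ψ a ^ n).coeff 0 =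
      monomial (s.mapDomain κ) (c * s.prod fun a n => ε a ^ n) := by
    rw [Polynomial.coeff_zero_eq_eval_zero, Polynomial.eval_mul, Finsupp.prod,
      Polynomial.eval_prod]
    simp only [Polynomial.eval_pow, ← Polynomial.coeff_zero_eq_eval_zero, hψ, mul_pow,
      Finset.prod_mul_distrib]
    rw [monomial_eq, Finsupp.prod_mapDomain_index (by simp) (by intros; rw [pow_add])]
    simp [Polynomial.algebraMap_apply, Finsupp.prod, mul_assoc]
  rw [h1, Polynomial.coeff_X_pow_mul']
  split_ifs with h3 h4 h4
  · rw [h4, Nat.sub_self, h2]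
  · exact absurd (le_antisymm h3 hl) h4
  · exact absurd h4.le h3
  · rfl

/-- Take `l` to be the least `β`-weight of a monomial of `p`. Only monomials of that weight reach
the coefficient of `X ^ l`, each through its image under `κ` times a nonzero scalar. Monotonicity of
`κ` keeps chains chains, and `hinj` rules out cancellation. -/
theorem exists_coeff_aeval {σ τ : Type*} [LE σ] [LE τ] (β : σ → ℕ) (κ : σ → τ) (ε : σ → ℂ)
    (hε : ∀ a, ε a ≠ 0) (ψ : σ → Polynomial (MvPolynomial τ ℂ))
    (hψ : ∀ a, (ψ a).coeff 0 = C (ε a) * X (κ a))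
    (hκ : ∀ a b, a ≤ b → κ a ≤ κ b)
    (hinj : ∀ s t : σ →₀ ℕ, IsChain (· ≤ ·) (s.support : Set σ) →
      IsChain (· ≤ ·) (t.support : Set σ) → Finsupp.weight β s = Finsupp.weight β t →
      s.mapDomain κ = t.mapDomain κ → s = t)
    {p : MvPolynomial σ ℂ} (hp : p ∈ stdSubmodule σ) (hp0 : p ≠ 0) :
    ∃ l, (aeval (fun a => Polynomial.X ^ β a * ψ a) p).coeff l ∈ stdSubmodule τ ∧
      (aeval (fun a => Polynomial.X ^ β a * ψ a) p).coeff l ≠ 0 := by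
  classical
  obtain ⟨s₀, hs₀, hmin⟩ := Finset.exists_min_image p.support (Finsupp.weight β)
    (support_nonempty.2 hp0)
  set l := Finsupp.weight β s₀ with hl
  have key : (aeval (fun a => Polynomial.X ^ β a * ψ a) p).coeff l =
      ∑ s ∈ p.support, if Finsupp.weight β s = l then
        monomial (s.mapDomain κ) (coeff s p * s.prod fun a n => ε a ^ n) else 0 := by
    conv_lhs => rw [p.as_sum]
    rw [map_sum, Polynomial.finsetSum_coeff]
    exact Finset.sum_congr rfl fun s hs =>
      coeff_aeval_monomial_of_le β κ ε ψ hψ s _ (hmin s hs)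
  refine ⟨l, ?_, fun h0 => ?_⟩
  · rw [key]
    refine Submodule.sum_mem _ fun s hs => ?_
    split_ifs
    · refine monomial_mem_stdSubmodule _ fun x hx y hy _ => ?_
      have hx' := Finsupp.mapDomain_support (Finset.mem_coe.1 hx)
      have hy' := Finsupp.mapDomain_support (Finset.mem_coe.1 hy)
      obtain ⟨a, ha, rfl⟩ := Finset.mem_image.1 hx'
      obtain ⟨b, hb, rfl⟩ := Finset.mem_image.1 hy'
      rcases eq_or_ne a b with rfl | hab
      · simp_all
      · exact (hp s hs ha hb hab).imp (hκ _ _) (hκ _ _)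
    · exact zero_mem _
  · have h1 := congrArg (coeff (s₀.mapDomain κ)) (key.symm.trans h0)
    rw [coeff_sum, Finset.sum_eq_single s₀] at h1
    · rw [if_pos rfl, coeff_monomial, if_pos rfl, coeff_zero, mul_eq_zero] at h1
      rcases h1 with h1 | h1
      · exact mem_support_iff.1 hs₀ h1
      · exact Finset.prod_ne_zero_iff.2 (fun a _ => pow_ne_zero _ (hε a)) h1
    · intro s hs hne
      split_ifs with hsl
      · rw [coeff_monomial, if_neg]
        exact fun h => hne (hinj s s₀ (hp s hs) (hp s₀ hs₀) hsl h)
      · exact coeff_zero _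
    · exact fun h => absurd hs₀ h

/-- The variable `λ^a`, or zero if `a` is not in `[d, d']`. -/
noncomputable def varOrZero (d d' a : AffWeight) : Poly d d' :=
  open Classical in if h : a ∈ Set.Icc d d' then X ⟨a, h⟩ else 0

theorem varOrZero_of_mem {a : AffWeight} (h : a ∈ Set.Icc d d') :
    varOrZero d d' a = X ⟨a, h⟩ := dif_pos h

theorem varOrZero_of_notMem {a : AffWeight} (h : a ∉ Set.Icc d d') :
    varOrZero d d' a = 0 := dif_neg h

theorem coeff_genFun (α : Weight) (l : ℤ) :
    (genFun d d' α).coeff l = varOrZero d d' ⟨α, l⟩ := by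
  classical
  have h : ∀ a : Set.Icc d d', (if a.1.weight = α then LaurentPolynomial.C (X a : Poly d d') *
      LaurentPolynomial.T a.1.level else 0).coeff l = if a.1 = ⟨α, l⟩ then X a else 0 := by
    intro a
    rw [AffWeight.ext_iff]
    by_cases ha : a.1.weight = α
    · rw [if_pos ha, ← LaurentPolynomial.single_eq_C_mul_T, AddMonoidAlgebra.coeff_single,
        Finsupp.single_apply]
      simp [ha]
    · simp [ha]
  rw [genFun, AddMonoidAlgebra.coeff_sum, Finsupp.finsetSum_apply,
    Finset.sum_congr rfl fun a _ => h a]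
  by_cases hm : (⟨α, l⟩ : AffWeight) ∈ Set.Icc d d'
  · rw [varOrZero_of_mem hm, Finset.sum_eq_single ⟨_, hm⟩]
    · simp
    · exact fun b _ hb => if_neg fun h => hb (Subtype.ext h)
    · simp
  · rw [varOrZero_of_notMem hm]
    exact Finset.sum_eq_zero fun a _ => if_neg fun (h : a.1 = ⟨α, l⟩) => hm (h ▸ a.2)

/-! ### Collapsing an interval along its top edge -/

theorem Step.le_of_le {i : Fin 6} {b a c d : AffWeight} (hba : Step i b a) (hcd : Step i c d)
    (hbc : b ≤ c) : a ≤ d :=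
  le_iff_rootCoord_le.2 fun j => by
    have h1 := hba j
    have h2 := hcd j
    have h3 := rootCoord_mono hbc j
    lia

theorem Step.le_of_le' {i : Fin 6} {b a c d : AffWeight} (hba : Step i b a) (hcd : Step i c d)
    (had : a ≤ d) : b ≤ c :=
  le_iff_rootCoord_le.2 fun j => by
    have h1 := hba j
    have h2 := hcd j
    have h3 := rootCoord_mono had j
    lia

/-- The endpoints `c` and `d` differ only in coordinate `i`, so only that coordinate can obstruct `a
≤ c`. -/
theorem Step.rootCoord_eq_of_le {i : Fin 6} {c d a : AffWeight} (h : Step i c d) (had : a ≤ d)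
    (hac : ¬ a ≤ c) : rootCoord a i = rootCoord d i := by
  by_contra hne
  refine hac (le_iff_rootCoord_le.2 fun j => ?_)
  have h1 := h j
  have h2 := rootCoord_mono had j
  split_ifs at h1 with hj
  · subst hj; lia
  · lia

/-- An element of `[., c]` below an element `a` of `[., d] \ [., c]` is below the source of the edge
with label `i` that ends in `a`. -/
theorem Step.le_of_le_of_not_le {i : Fin 6} {c d a b x : AffWeight} (h : Step i c d) (had : a ≤ d)
    (hac : ¬ a ≤ c) (hb : Step i b a) (hx : x ≤ c) (hxa : x ≤ a) : x ≤ b :=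
  le_iff_rootCoord_le.2 fun j => by
    have h1 := h j
    have h2 := hb j
    have h3 := rootCoord_mono hx j
    have h4 := rootCoord_mono hxa j
    have h5 := h.rootCoord_eq_of_le had hac
    split_ifs at h1 h2 with hj
    · subst hj; lia
    · lia

/-- The map from `[d, d']` to `[d, d'']`, for an edge with label `i` from `d''` to `d'`, that moves
the elements outside `[d, d'']` down along edges with label `i`. -/
theorem exists_collapse {i : Fin 6} {d'' : AffWeight} (h : Step i d'' d') (hd : d ≤ d'') :
    ∃ κ : Set.Icc d d' → Set.Icc d d'',
      (∀ a, a.1 ≤ d'' → (κ a).1 = a.1) ∧ (∀ a, ¬ a.1 ≤ d'' → Step i (κ a).1 a.1) ∧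
      ∀ a b, a ≤ b → κ a ≤ κ b := by
  have key : ∀ a : Set.Icc d d', ∃ b : Set.Icc d d'',
      (a.1 ≤ d'' → b.1 = a.1) ∧ (¬ a.1 ≤ d'' → Step i b.1 a.1) := by
    intro a
    by_cases ha : a.1 ≤ d''
    · exact ⟨⟨a.1, a.2.1, ha⟩, fun _ => rfl, fun h => absurd ha h⟩
    · obtain ⟨b, hb⟩ := h.exists_step_of_le a.2.2 ha
      exact ⟨⟨b, h.le_of_le_of_not_le a.2.2 ha hb hd a.2.1, hb.le_of_le' h a.2.2⟩,
        fun h => absurd h ha, fun _ => hb⟩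
  choose κ h1 h2 using key
  refine ⟨κ, h1, h2, fun a b hab => ?_⟩
  change (κ a).1 ≤ (κ b).1
  by_cases hb : b.1 ≤ d''
  · rw [h1 b hb, h1 a (le_trans (show a.1 ≤ b.1 from hab) hb)]
    exact hab
  · by_cases ha : a.1 ≤ d''
    · rw [h1 a ha]
      exact h.le_of_le_of_not_le b.2.2 hb (h2 b hb) ha hab
    · exact (h2 a ha).le_of_le' (h2 b hb) hab

open Classical in
theorem collapse_injOn {i : Fin 6} {d'' : AffWeight} (h : Step i d'' d')
    (κ : Set.Icc d d' → Set.Icc d d'') (h1 : ∀ a, a.1 ≤ d'' → (κ a).1 = a.1)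
    (h2 : ∀ a, ¬ a.1 ≤ d'' → Step i (κ a).1 a.1) (s t : Set.Icc d d' →₀ ℕ)
    (hs : IsChain (· ≤ ·) (s.support : Set (Set.Icc d d')))
    (ht : IsChain (· ≤ ·) (t.support : Set (Set.Icc d d')))
    (hw : Finsupp.weight (fun a : Set.Icc d d' => if a.1 ≤ d'' then 0 else 1) s =
      Finsupp.weight (fun a : Set.Icc d d' => if a.1 ≤ d'' then 0 else 1) t)
    (hst : s.mapDomain κ = t.mapDomain κ) : s = t := by
  have hle : d'' ≤ d' := h.le
  -- the copy in `[d, d']` of the image of an element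
  let ι : Set.Icc d d'' → Set.Icc d d' := fun a => ⟨a.1, a.2.1, a.2.2.trans hle⟩
  have hκι : ∀ a, κ (ι a) = a := fun a => Subtype.ext (h1 (ι a) a.2.2)
  have hsingle : ∀ a b : Set.Icc d d', ¬ a.1 ≤ d'' → ¬ b.1 ≤ d'' → κ a = κ b → a = b := by
    intro a b ha hb hab
    have h3 := h2 a ha
    rw [hab] at h3
    exact Subtype.ext (h3.unique_right (h2 b hb))
  -- The fibre of `κ` over `κ a` consists of `a` and of `κ a` itself, so fixing the exponent of one
  -- of them determines the other.
  have hfib : ∀ (u : Set.Icc d d' →₀ ℕ) (a : Set.Icc d d'), ¬ a.1 ≤ d'' →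
      u.mapDomain κ (κ a) = u (ι (κ a)) + u a := by
    intro u a ha
    have hne : ι (κ a) ≠ a := fun hc => ha (by rw [← hc]; exact (κ a).2.2)
    rw [Finsupp.mapDomain, Finsupp.sum_apply, Finsupp.sum_fintype _ _ (by simp),
      ← Finset.sum_subset (Finset.subset_univ {ι (κ a), a}), Finset.sum_pair hne]
    · simp [hκι]
    · intro x _ hx
      rw [Finsupp.single_apply, if_neg]
      intro hc
      simp only [Finset.mem_insert, Finset.mem_singleton, not_or] at hx
      by_cases hx' : x.1 ≤ d''
      · exact hx.1 (Subtype.ext ((h1 x hx').symm.trans (congrArg Subtype.val hc)))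
      · exact hx.2 (hsingle x a hx' ha hc)
  have hfib' : ∀ (u : Set.Icc d d' →₀ ℕ) (a : Set.Icc d d'), a.1 ≤ d'' →
      (∀ b : Set.Icc d d', ¬ b.1 ≤ d'' → κ b ≠ κ a) → u.mapDomain κ (κ a) = u a := by
    intro u a ha hb
    rw [Finsupp.mapDomain, Finsupp.sum_apply, Finsupp.sum_fintype _ _ (by simp),
      Finset.sum_eq_single a]
    · simp
    · intro x _ hx
      rw [Finsupp.single_apply, if_neg]
      intro hc
      by_cases hx' : x.1 ≤ d''
      · exact hx (Subtype.ext ((h1 x hx').symm.trans ((congrArg Subtype.val hc).trans (h1 a ha))))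
      · exact hb x hx' hc
    · simp
  have hpair : ∀ (u : Set.Icc d d' →₀ ℕ), IsChain (· ≤ ·) (u.support : Set (Set.Icc d d')) →
      ∀ a b : Set.Icc d d', ¬ a.1 ≤ d'' → ¬ b.1 ≤ d'' → u (ι (κ a)) ≠ 0 → u b ≠ 0 →
        κ a ≤ κ b := by
    intro u hu a b ha hb hua hub
    have hne : ι (κ a) ≠ b := fun hc => hb (by rw [← hc]; exact (κ a).2.2)
    rcases hu (Finsupp.mem_support_iff.2 hua) (Finsupp.mem_support_iff.2 hub) hne with h3 | h3
    · exact h.le_of_le_of_not_le b.2.2 hb (h2 b hb) (κ a).2.2 h3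
    · exact absurd (le_trans (show b.1 ≤ (κ a).1 from h3) (κ a).2.2) hb
  -- the exponents outside `[d, d'']` agree
  have hB : ∀ a : Set.Icc d d', ¬ a.1 ≤ d'' → s a = t a := by
    by_contra! hc
    have hsum : ∑ a : {a : Set.Icc d d' // ¬ a.1 ≤ d''}, s a.1 =
        ∑ a : {a : Set.Icc d d' // ¬ a.1 ≤ d''}, t a.1 := by
      have hwt : ∀ u : Set.Icc d d' →₀ ℕ,
          Finsupp.weight (fun a : Set.Icc d d' => if a.1 ≤ d'' then 0 else 1) u =
            ∑ a : {a : Set.Icc d d' // ¬ a.1 ≤ d''}, u a.1 := by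
        intro u
        rw [Finsupp.weight_apply, Finsupp.sum_fintype _ _ (by simp),
          ← Finset.sum_subtype (Finset.univ.filter fun a : Set.Icc d d' => ¬ a.1 ≤ d'')
            (by simp) (fun a => u a), Finset.sum_filter]
        refine Finset.sum_congr rfl fun a _ => ?_
        split_ifs <;> simp
      rw [← hwt, ← hwt, hw]
    have hlt : ∃ a : Set.Icc d d', ¬ a.1 ≤ d'' ∧ t a < s a := by
      by_contra! hle'
      obtain ⟨a, ha, hne⟩ := hc
      exact hne ((Finset.sum_eq_sum_iff_of_le fun (x : {a : Set.Icc d d' // ¬ a.1 ≤ d''}) _ =>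
        hle' x.1 x.2).1 hsum ⟨a, ha⟩ (Finset.mem_univ _))
    have hgt : ∃ a : Set.Icc d d', ¬ a.1 ≤ d'' ∧ s a < t a := by
      by_contra! hle'
      obtain ⟨a, ha, hne⟩ := hc
      exact hne ((Finset.sum_eq_sum_iff_of_le fun (x : {a : Set.Icc d d' // ¬ a.1 ≤ d''}) _ =>
        hle' x.1 x.2).1 hsum.symm ⟨a, ha⟩ (Finset.mem_univ _)).symm
    -- Counting fibres, `t` contains both `κ a` and `b`, while `s` contains both `κ b` and `a`. The
    -- chain conditions give `κ a ≤ κ b` and `κ b ≤ κ a`, hence `a = b`, which contradicts the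
    -- opposite inequalities.
    obtain ⟨a, ha, hta⟩ := hlt
    obtain ⟨b, hb, hsb⟩ := hgt
    have ha' := hfib s a ha
    have hb' := hfib s b hb
    rw [hst, hfib t a ha] at ha'
    rw [hst, hfib t b hb] at hb'
    have h3 := hpair t ht a b ha hb (by lia) (by lia)
    have h4 := hpair s hs b a hb ha (by lia) (by lia)
    have h5 := hsingle a b ha hb (le_antisymm h3 h4)
    subst h5
    lia
  ext a
  by_cases ha : a.1 ≤ d''
  · by_cases hb : ∃ b : Set.Icc d d', ¬ b.1 ≤ d'' ∧ κ b = κ a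
    · obtain ⟨b, hb, hba⟩ := hb
      have hab : ι (κ b) = a := Subtype.ext (by rw [hba]; exact h1 a ha)
      have h3 := hfib s b hb
      rw [hst, hfib t b hb, hab, hB b hb] at h3
      lia
    · push Not at hb
      rw [← hfib' s a ha hb, hst, hfib' t a ha hb]
  · exact hB a ha

/-! ### The root subgroup acting on the universal spinor -/

theorem coeff_C_mul_T_mul {R : Type*} [CommRing R] (r : R) (k l : ℤ) (F : LaurentPolynomial R) :
    (LaurentPolynomial.C r * LaurentPolynomial.T k * F).coeff l = r * F.coeff (l - k) := by
  rw [← LaurentPolynomial.single_eq_C_mul_T]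
  exact AddMonoidAlgebra.coeff_single_mul_eq_mul_coeff _ fun m _ => by lia

theorem coeff_C_mul {R : Type*} [CommRing R] (r : R) (l : ℤ) (F : LaurentPolynomial R) :
    (LaurentPolynomial.C r * F).coeff l = r * F.coeff l := by
  simpa using coeff_C_mul_T_mul r 0 l F

theorem coeff_T_mul {R : Type*} [CommRing R] (k l : ℤ) (F : LaurentPolynomial R) :
    (LaurentPolynomial.T k * F).coeff l = F.coeff (l - k) := by
  simpa using coeff_C_mul_T_mul 1 k l F

/-- The image of the spinor `λ(z)` under a homomorphism of the coefficient ring. -/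
noncomputable def mapGenFun {B : Type*} [CommRing B] (f : Poly d d' →+* B) (α : Weight) :
    LaurentPolynomial B :=
  AddMonoidAlgebra.mapRingHom ℤ f (genFun d d' α)

theorem coeff_mapGenFun {B : Type*} [CommRing B] (f : Poly d d' →+* B) (α : Weight) (l : ℤ) :
    (mapGenFun f α).coeff l = f (varOrZero d d' ⟨α, l⟩) := by
  rw [mapGenFun, AddMonoidAlgebra.coeff_mapRingHom, coeff_genFun]

theorem Gam_mapGenFun_comp {B B' : Type*} [CommRing B] [CommRing B'] [Algebra ℂ B] [Algebra ℂ B']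
    (f : Poly d d' →ₐ[ℂ] B) (e : B →ₐ[ℂ] B') {s : VecIndex}
    (h : Gam s (mapGenFun (f : Poly d d' →+* B)) = 0) :
    Gam s (mapGenFun (e.comp f : Poly d d' →+* B')) = 0 := by
  have h1 : mapGenFun (e.comp f : Poly d d' →+* B') =
      fun α => AddMonoidAlgebra.mapRingHom ℤ (e : B →+* B')
        (mapGenFun (f : Poly d d' →+* B) α) := by
    funext α
    refine LaurentPolynomial.ext fun l => ?_
    rw [AddMonoidAlgebra.coeff_mapRingHom, coeff_mapGenFun, coeff_mapGenFun]
    rfl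
  rw [h1, ← map_Gam, h, map_zero]

theorem relIdeal_le_ker {B : Type*} [CommRing B] (f : Poly d d' →+* B)
    (h : ∀ s, Gam s (mapGenFun f) = 0) : relIdeal d d' ≤ RingHom.ker f := by
  refine Ideal.span_le.2 ?_
  rintro _ ⟨⟨s, l⟩, rfl⟩
  have h1 := h s
  unfold mapGenFun at h1
  rw [← map_Gam] at h1
  have h2 := congrArg (fun F : LaurentPolynomial B => F.coeff l) h1
  simpa [rel] using h2

/-- The sum of the variables obtained by lowering along an edge with label `i`. -/
noncomputable def lowerVar (i : Fin 6) (d d' a : AffWeight) : Poly d d' :=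
  match lower i a.weight with
  | some p => (actSign i a.weight : Poly d d') * varOrZero d d' ⟨p.1, a.level - p.2⟩
  | none => 0

/-- The action of a root subgroup with parameter `X` on the universal spinor of `[d, d'']`. -/
noncomputable def lowerHom (i : Fin 6) (d d' d'' : AffWeight) :
    Poly d d' →ₐ[ℂ] Polynomial (Poly d d'') :=
  aeval fun a : Set.Icc d d' => Polynomial.C (varOrZero d d'' a) +
    Polynomial.X * Polynomial.C (lowerVar i d d'' a)

/-- The content is the case of `a` outside `[d, d']`: lowering `a` along label `i` cannot land in
`[d, d'']`, so the action creates no coordinates outside `[d, d']`. -/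
theorem lowerHom_varOrZero {i : Fin 6} {d'' : AffWeight} (h : Step i d'' d') (a : AffWeight) :
    lowerHom i d d' d'' (varOrZero d d' a) = Polynomial.C (varOrZero d d'' a) +
      Polynomial.X * Polynomial.C (lowerVar i d d'' a) := by
  by_cases ha : a ∈ Set.Icc d d'
  · rw [varOrZero_of_mem ha, lowerHom, aeval_X]
  · rw [varOrZero_of_notMem ha, map_zero, varOrZero_of_notMem fun hc =>
      ha ⟨hc.1, hc.2.trans h.le⟩]
    have : lowerVar i d d'' a = 0 := by
      unfold lowerVar
      split
      · rename_i p hp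
        rw [varOrZero_of_notMem, mul_zero]
        intro hc
        have hs : Step i ⟨p.1, a.level - p.2⟩ a := step_of_lower hp a.level
        exact ha ⟨hc.1.trans hs.le, hs.le_of_le h hc.2⟩
      · rfl
    simp [this]

theorem lowerVar_of_step {i : Fin 6} {a b : AffWeight} (h : Step i b a) :
    lowerVar i d d' a = (actSign i a.weight : Poly d d') * varOrZero d d' b := by
  simp [lowerVar, h.lower_eq]

/-- The composite is the spinor of `f` moved by a root subgroup element, with the loop parameter `z`
entering through `LaurentPolynomial.T`; each new form is a combination of the old ones, which
vanish. -/
theorem Gam_mapGenFun_lowerHom {i : Fin 6} {d'' : AffWeight} (h : Step i d'' d') {B : Type*}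
    [CommRing B] [Algebra ℂ B] (f : Poly d d'' →ₐ[ℂ] B)
    (hf : ∀ s, Gam s (mapGenFun (f : Poly d d'' →+* B)) = 0) (s : VecIndex) :
    Gam s (mapGenFun (((Polynomial.mapAlgHom f).comp (lowerHom i d d' d'') :
      Poly d d' →ₐ[ℂ] Polynomial B) : Poly d d' →+* Polynomial B)) = 0 := by
  set L := AddMonoidAlgebra.mapRingHom ℤ (Polynomial.C : B →+* Polynomial B)
  set x : Weight → LaurentPolynomial (Polynomial B) :=
    fun α => L (mapGenFun (f : Poly d d'' →+* B) α) with hx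
  have hGx : ∀ s, Gam s x = 0 := fun s => by rw [hx, ← map_Gam, hf, map_zero]
  have hL : ∀ α l, (x α).coeff l = Polynomial.C (f (varOrZero d d'' ⟨α, l⟩)) := fun α l => by
    rw [hx]
    dsimp only
    rw [AddMonoidAlgebra.coeff_mapRingHom, coeff_mapGenFun]
    rfl
  have key : mapGenFun (((Polynomial.mapAlgHom f).comp (lowerHom i d d' d'') :
      Poly d d' →ₐ[ℂ] Polynomial B) : Poly d d' →+* Polynomial B) = fun α => x α +
      LaurentPolynomial.C Polynomial.X * lowerAct i LaurentPolynomial.T x α := by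
    funext α
    refine LaurentPolynomial.ext fun l => ?_
    rw [coeff_mapGenFun, AddMonoidAlgebra.coeff_add, Finsupp.add_apply, hL]
    simp only [AlgHom.coe_toRingHom, AlgHom.comp_apply, lowerHom_varOrZero h, map_add, map_mul]
    rw [coeff_C_mul]
    congr 1
    · simp
    · congr 1
      · simp
      · unfold lowerAct lowerVar
        cases hα : lower i α with
        | none => simp
        | some p =>
          simp only
          rw [← zsmul_eq_mul, ← zsmul_eq_mul, map_zsmul, map_zsmul]
          refine Eq.trans (congrArg (actSign i α • ·) ?_)
            (AddMonoidAlgebra.coeff_smul_apply _ _ _).symm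
          rw [coeff_T_mul, hL]
          simp
  rw [key]
  obtain ⟨s', e, he⟩ := Gam_add_lowerAct i LaurentPolynomial.T LaurentPolynomial.T_zero x
    (LaurentPolynomial.C Polynomial.X) s
  rw [he, hGx, hGx, mul_zero, add_zero]

theorem exists_coeff_lowerHom {i : Fin 6} {d'' : AffWeight} (h : Step i d'' d') (hd : d ≤ d'')
    {p : Poly d d'} (hp : p ∈ stdSubmodule (Set.Icc d d')) (hp0 : p ≠ 0) :
    ∃ l, (lowerHom i d d' d'' p).coeff l ∈ stdSubmodule (Set.Icc d d'') ∧
      (lowerHom i d d' d'' p).coeff l ≠ 0 := by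
  classical
  obtain ⟨κ, h1, h2, h3⟩ := exists_collapse h hd
  set β : Set.Icc d d' → ℕ := fun a => if a.1 ≤ d'' then 0 else 1 with hβ
  set ε : Set.Icc d d' → ℂ := fun a => if a.1 ≤ d'' then 1 else (actSign i a.1.weight : ℂ) with hε
  -- For `a` outside `[d, d'']` only the lowered term survives, and `β` records its factor
  -- `Polynomial.X`; for `a` inside, the constant term is the variable itself.
  set ψ : Set.Icc d d' → Polynomial (Poly d d'') := fun a =>
    if a.1 ≤ d'' then Polynomial.C (X (κ a)) + Polynomial.X * Polynomial.C (lowerVar i d d'' a)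
    else Polynomial.C (C (actSign i a.1.weight : ℂ) * X (κ a)) with hψ
  have hφ : lowerHom i d d' d'' = aeval fun a => Polynomial.X ^ β a * ψ a := by
    rw [lowerHom]
    congr 1
    funext a
    by_cases ha : a.1 ≤ d''
    · simp only [hβ, hψ, if_pos ha, pow_zero, one_mul]
      rw [varOrZero_of_mem ⟨a.2.1, ha⟩, (Subtype.ext (h1 a ha).symm :
        (⟨a.1, a.2.1, ha⟩ : Set.Icc d d'') = κ a)]
    · simp only [hβ, hψ, if_neg ha, pow_one]
      rw [varOrZero_of_notMem fun hc => ha hc.2, lowerVar_of_step (h2 a ha),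
        varOrZero_of_mem (κ a).2]
      simp
  rw [hφ]
  refine exists_coeff_aeval β κ ε (fun a => ?_) ψ (fun a => ?_) h3
    (fun s t hs ht hw hst => collapse_injOn h κ h1 h2 s t hs ht hw hst) hp hp0
  · rcases actSign_eq i a.1.weight with h4 | h4 <;> simp only [hε, h4] <;> split_ifs <;> simp
  · simp only [hψ, hε]
    split_ifs <;> simp

/-! ### Embedding into a polynomial ring -/

theorem exists_embedding_self (d : AffWeight) : ∃ f : Poly d d →ₐ[ℂ] MvPolynomial (Fin 1) ℂ,
    (∀ s, Gam s (mapGenFun (f : Poly d d →+* MvPolynomial (Fin 1) ℂ)) = 0) ∧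
      Function.Injective f := by
  have hu : ∀ a : Set.Icc d d, a.1 = d := fun a => le_antisymm a.2.2 a.2.1
  refine ⟨rename fun _ => 0, fun s => ?_, rename_injective _ fun a b _ =>
    Subtype.ext ((hu a).trans (hu b).symm)⟩
  have hz : ∀ α, α ≠ d.weight → mapGenFun ((rename fun _ => 0 :
      Poly d d →ₐ[ℂ] MvPolynomial (Fin 1) ℂ) : Poly d d →+* MvPolynomial (Fin 1) ℂ) α = 0 := by
    intro α hα
    refine LaurentPolynomial.ext fun l => ?_
    rw [coeff_mapGenFun, varOrZero_of_notMem]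
    · simp
    · exact fun hc => hα (congrArg AffWeight.weight (hu ⟨_, hc⟩))
  rw [Gam_eq_sum]
  refine Finset.sum_eq_zero fun j _ => ?_
  by_cases h1 : (quadPair s j).1 = d.weight
  · rw [hz _ fun h2 => quadPair_fst_ne_snd s j j (h1.trans h2.symm), mul_zero, mul_zero]
  · rw [hz _ h1, zero_mul, mul_zero]

/-- The parametrization of the variety of an interval by an affine space. -/
theorem exists_embedding (n : ℕ) (hd : d ≤ d') (hn : ht d' - ht d = n) :
    ∃ f : Poly d d' →ₐ[ℂ] MvPolynomial (Fin (n + 1)) ℂ,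
      (∀ s, Gam s (mapGenFun (f : Poly d d' →+* MvPolynomial (Fin (n + 1)) ℂ)) = 0) ∧
      ∀ p ∈ stdSubmodule (Set.Icc d d'), f p = 0 → p = 0 := by
  induction n generalizing d' with
  | zero =>
    obtain rfl : d = d' := by
      rcases ht_le_of_path hd with h | h
      · exact h
      · lia
    obtain ⟨f, hf, hinj⟩ := exists_embedding_self d
    exact ⟨f, hf, fun p _ hp => hinj (hp.trans (map_zero f).symm)⟩
  | succ n ih =>
    rcases (Relation.ReflTransGen.cases_tail_iff _ _ _).1 hd with h | ⟨d'', hd'', harr⟩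
    · subst h; lia
    have hd'' : d ≤ d'' := hd''
    obtain ⟨i, hi⟩ := harr.exists_step
    obtain ⟨f, hf, hinj⟩ := ih hd'' (by have := hi.ht_eq; push_cast at hn; lia)
    -- The parameter of the root subgroup becomes one more polynomial variable.
    set e := (finSuccEquiv ℂ (n + 1)).symm
    set g := (Polynomial.mapAlgHom f).comp (lowerHom i d d' d'') with hg
    refine ⟨e.toAlgHom.comp g, fun s => ?_, fun p hp hp0 => ?_⟩
    · exact Gam_mapGenFun_comp g e.toAlgHom (Gam_mapGenFun_lowerHom hi f hf s)
    · by_contra hne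
      obtain ⟨l, hl, hl0⟩ := exists_coeff_lowerHom hi hd'' hp hne
      refine hl0 (hinj _ hl ?_)
      have h1 : g p = 0 := e.injective (hp0.trans (map_zero e).symm)
      have h2 := congrArg (fun F => Polynomial.coeff F l) h1
      simpa [hg, Polynomial.coeff_map] using h2

end PureSpinor

/-! ### Weakly regular sequences and exact sequences -/

namespace RingTheory.Sequence.IsWeaklyRegular

open Function
open scoped Pointwise

universe u v

variable {R : Type u} [CommRing R]

/-- Regularity of `r` on `M₃` kills the `Tor` term that would obstruct injectivity modulo `r`. -/
theorem _root_.QuotSMulTop.map_injective_of_exact {M₁ M₂ M₃ : Type v} [AddCommGroup M₁]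
    [AddCommGroup M₂] [AddCommGroup M₃] [Module R M₁] [Module R M₂] [Module R M₃] {r : R}
    {f : M₁ →ₗ[R] M₂} {g : M₂ →ₗ[R] M₃} (hf : Injective f) (hfg : Exact f g)
    (hr : IsSMulRegular M₃ r) : Injective (QuotSMulTop.map r f) := by
  rw [injective_iff_map_eq_zero]
  intro x hx
  obtain ⟨x, rfl⟩ := Submodule.mkQ_surjective _ x
  rw [Submodule.mkQ_apply] at hx ⊢
  erw [QuotSMulTop.map_apply_mk] at hx
  rw [Submodule.Quotient.mk_eq_zero] at hx ⊢
  obtain ⟨y, -, hy⟩ := (Submodule.mem_smul_pointwise_iff_exists _ _ _).1 hx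
  have h1 : g y = 0 := hr (by simp [← map_smul, hy, hfg.apply_apply_eq_zero])
  obtain ⟨z, rfl⟩ := (hfg y).1 h1
  have h2 : r • z = x := hf (by rw [map_smul, hy])
  rw [← h2]
  exact Submodule.smul_mem_pointwise_smul _ _ _ trivial

theorem of_exact {M₁ M₂ M₃ : Type v} [AddCommGroup M₁]
    [AddCommGroup M₂] [AddCommGroup M₃] [Module R M₁] [Module R M₂] [Module R M₃]
    {f : M₁ →ₗ[R] M₂} {g : M₂ →ₗ[R] M₃} {rs : List R} (hf : Injective f) (hfg : Exact f g)
    (hg : Surjective g) (h1 : IsWeaklyRegular M₁ rs) (h3 : IsWeaklyRegular M₃ rs) :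
    IsWeaklyRegular M₂ rs := by
  induction rs generalizing M₁ M₂ M₃ with
  | nil => exact .nil R M₂
  | cons r rs ih =>
    rw [isWeaklyRegular_cons_iff] at h1 h3 ⊢
    refine ⟨isSMulRegular_of_range_eq_ker hf hfg.linearMap_ker_eq.symm h1.1 h3.1, ?_⟩
    exact ih (QuotSMulTop.map_injective_of_exact hf hfg h3.1) (QuotSMulTop.map_exact r hfg hg)
      (QuotSMulTop.map_surjective r hg) h1.2 h3.2

theorem of_exact_left {M₁ M₂ M₃ : Type v} [AddCommGroup M₁]
    [AddCommGroup M₂] [AddCommGroup M₃] [Module R M₁] [Module R M₂] [Module R M₃]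
    {f : M₁ →ₗ[R] M₂} {g : M₂ →ₗ[R] M₃} {rs : List R} (hf : Injective f) (hfg : Exact f g)
    (hg : Surjective g) (h2 : IsWeaklyRegular M₂ rs) (h3 : IsWeaklyRegular M₃ rs) :
    IsWeaklyRegular M₁ rs := by
  induction rs generalizing M₁ M₂ M₃ with
  | nil => exact .nil R M₁
  | cons r rs ih =>
    rw [isWeaklyRegular_cons_iff] at h2 h3 ⊢
    refine ⟨IsSMulRegular.of_injective f hf h2.1, ?_⟩
    exact ih (QuotSMulTop.map_injective_of_exact hf hfg h3.1) (QuotSMulTop.map_exact r hfg hg)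
      (QuotSMulTop.map_surjective r hg) h2.2 h3.2

theorem prod {M₁ M₂ : Type v} [AddCommGroup M₁] [AddCommGroup M₂] [Module R M₁] [Module R M₂]
    {rs : List R} (h1 : IsWeaklyRegular M₁ rs) (h2 : IsWeaklyRegular M₂ rs) :
    IsWeaklyRegular (M₁ × M₂) rs :=
  of_exact LinearMap.inl_injective Exact.inl_snd LinearMap.snd_surjective h1 h2

/-- Since `y` is regular on `N` and kills `Q`, the snake lemma gives an exact sequence `0 → Q → M/yM
→ N/yN → Q → 0`. Splitting it at the kernel of `N/yN → Q` shows that `rs` is weakly regular on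
`M/yM`. -/
theorem snake {M N Q : Type v} [AddCommGroup M]
    [AddCommGroup N] [AddCommGroup Q] [Module R M] [Module R N] [Module R Q]
    {f : M →ₗ[R] N} {g : N →ₗ[R] Q} {y : R} {rs : List R} (hf : Injective f) (hfg : Exact f g)
    (hg : Surjective g) (hy : ∀ q : Q, y • q = 0) (hN : IsWeaklyRegular N (y :: rs))
    (hQ : IsWeaklyRegular Q rs) : IsWeaklyRegular M (y :: rs) := by
  rw [isWeaklyRegular_cons_iff] at hN ⊢
  obtain ⟨hyN, hN⟩ := hN
  refine ⟨IsSMulRegular.of_injective f hf hyN, ?_⟩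
  -- the induced map `N / y N → Q` and its kernel
  have hle : y • (⊤ : Submodule R N) ≤ LinearMap.ker g := by
    rintro _ ⟨n, -, rfl⟩
    simpa using hy (g n)
  let g' : QuotSMulTop y N →ₗ[R] Q := Submodule.liftQ _ g hle
  have hg' : Surjective g' := fun q => by
    obtain ⟨n, rfl⟩ := hg q
    exact ⟨Submodule.Quotient.mk n, rfl⟩
  have hK : IsWeaklyRegular (LinearMap.ker g') rs :=
    of_exact_left (Submodule.injective_subtype _) (LinearMap.exact_subtype_ker_map g') hg' hN hQ
  let f' : QuotSMulTop y M →ₗ[R] QuotSMulTop y N := QuotSMulTop.map y f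
  have hf'mk : ∀ m, f' (Submodule.Quotient.mk m) = Submodule.Quotient.mk (f m) := fun m => rfl
  have hf'g' : ∀ x, f' x ∈ LinearMap.ker g' := fun x => by
    obtain ⟨m, rfl⟩ := Submodule.mkQ_surjective _ x
    exact hfg.apply_apply_eq_zero m
  have hsurj : Surjective (f'.codRestrict _ hf'g') := by
    rintro ⟨x, hx⟩
    obtain ⟨n, rfl⟩ := Submodule.mkQ_surjective _ x
    obtain ⟨m, rfl⟩ := (hfg n).1 hx
    exact ⟨Submodule.Quotient.mk m, rfl⟩
  -- the connecting homomorphism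
  have hr : ∀ n, (LinearMap.lsmul R N y) n ∈ LinearMap.range f := fun n =>
    (hfg (y • n)).1 (by rw [map_smul, hy])
  let e : N →ₗ[R] M := (LinearEquiv.ofInjective f hf).symm.toLinearMap ∘ₗ
    (LinearMap.lsmul R N y).codRestrict _ hr
  have he : ∀ n, f (e n) = y • n := fun n =>
    congrArg Subtype.val ((LinearEquiv.ofInjective f hf).apply_symm_apply ⟨_, hr n⟩)
  let α : N →ₗ[R] QuotSMulTop y M := Submodule.mkQ _ ∘ₗ e
  have hkerα : LinearMap.ker g = LinearMap.ker α := by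
    ext n
    rw [LinearMap.mem_ker, LinearMap.mem_ker]
    refine (hfg n).trans ⟨?_, fun h => ?_⟩
    · rintro ⟨m, rfl⟩
      refine (Submodule.Quotient.mk_eq_zero _).2 ?_
      have : e (f m) = y • m := hf (by rw [he, map_smul])
      rw [this]
      exact Submodule.smul_mem_pointwise_smul _ _ _ trivial
    · obtain ⟨m, -, hm⟩ := (Submodule.mem_smul_pointwise_iff_exists _ _ _).1
        ((Submodule.Quotient.mk_eq_zero _).1 h)
      exact ⟨m, hyN (by change y • f m = y • n; rw [← he n, ← hm, map_smul])⟩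
  have hrangeα : LinearMap.range α = LinearMap.ker (f'.codRestrict _ hf'g') := by
    rw [LinearMap.ker_codRestrict]
    ext x
    constructor
    · rintro ⟨n, rfl⟩
      change f' (Submodule.Quotient.mk (e n)) = 0
      rw [hf'mk, he]
      exact (Submodule.Quotient.mk_eq_zero _).2 (Submodule.smul_mem_pointwise_smul _ _ _ trivial)
    · intro hx
      obtain ⟨m, rfl⟩ := Submodule.mkQ_surjective _ x
      obtain ⟨n, -, hn⟩ := (Submodule.mem_smul_pointwise_iff_exists _ _ _).1
        ((Submodule.Quotient.mk_eq_zero _).1 (show Submodule.Quotient.mk (f m) = _ from hx))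
      exact ⟨n, congrArg (Submodule.mkQ _) (hf (by rw [he, hn]))⟩
  have hP : IsWeaklyRegular (LinearMap.ker (f'.codRestrict _ hf'g')) rs :=
    ((g.quotKerEquivOfSurjective hg).symm ≪≫ₗ Submodule.quotEquivOfEq _ _ hkerα ≪≫ₗ
      α.quotKerEquivRange ≪≫ₗ LinearEquiv.ofEq _ _ hrangeα).isWeaklyRegular_congr rs |>.1 hQ
  exact of_exact (Submodule.injective_subtype _) (LinearMap.exact_subtype_ker_map _) hsurj hP hK

theorem quotient_cons_iff {J : Ideal R} {y : R} {rs : List R} :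
    IsWeaklyRegular (R ⧸ J) (y :: rs) ↔
      (∀ x, y * x ∈ J → x ∈ J) ∧ IsWeaklyRegular (R ⧸ (J ⊔ Ideal.span {y})) rs := by
  rw [isWeaklyRegular_cons_iff]
  refine and_congr ?_ ?_
  · rw [isSMulRegular_quotient_iff_mem_of_smul_mem]
    rfl
  · have h : y • (⊤ : Submodule R (R ⧸ J)) = Submodule.map J.mkQ (Ideal.span {y}) := by
      rw [← Submodule.ideal_span_singleton_smul, ← Submodule.range_mkQ J, ← Submodule.map_top,
        ← Submodule.map_smul'', smul_eq_mul, Ideal.mul_top]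
    exact (Submodule.quotEquivOfEq _ _ h ≪≫ₗ
      Submodule.quotientQuotientEquivQuotientSup J (Ideal.span {y})).isWeaklyRegular_congr rs

/-- The Mayer-Vietoris sequence of two ideals. -/
theorem quotient_inf {J₁ J₂ : Ideal R} {y : R} {rs : List R} (hy : y ∈ J₁ ⊔ J₂)
    (h1 : IsWeaklyRegular (R ⧸ J₁) (y :: rs)) (h2 : IsWeaklyRegular (R ⧸ J₂) (y :: rs))
    (h12 : IsWeaklyRegular (R ⧸ (J₁ ⊔ J₂)) rs) : IsWeaklyRegular (R ⧸ (J₁ ⊓ J₂)) (y :: rs) := by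
  let f : (R ⧸ (J₁ ⊓ J₂)) →ₗ[R] (R ⧸ J₁) × (R ⧸ J₂) :=
    Submodule.liftQ _ (J₁.mkQ.prod J₂.mkQ) (by
      rw [LinearMap.ker_prod, Submodule.ker_mkQ, Submodule.ker_mkQ])
  let g : (R ⧸ J₁) × (R ⧸ J₂) →ₗ[R] R ⧸ (J₁ ⊔ J₂) :=
    (Submodule.factor le_sup_left).coprod (-Submodule.factor le_sup_right)
  have hg : ∀ a b : R, g (Submodule.Quotient.mk a, Submodule.Quotient.mk b) =
      Submodule.Quotient.mk (a - b) := fun a b => by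
    rw [Submodule.Quotient.mk_sub, sub_eq_add_neg]
    rfl
  refine snake (f := f) (g := g) ?_ ?_ ?_ ?_ (prod h1 h2) h12
  · rw [← LinearMap.ker_eq_bot, Submodule.ker_liftQ_eq_bot _ _ _ (by
      rw [LinearMap.ker_prod, Submodule.ker_mkQ, Submodule.ker_mkQ])]
  · rintro ⟨a, b⟩
    obtain ⟨a, rfl⟩ := Submodule.mkQ_surjective _ a
    obtain ⟨b, rfl⟩ := Submodule.mkQ_surjective _ b
    constructor
    · intro h
      obtain ⟨u, hu, v, hv, huv⟩ := Submodule.mem_sup.1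
        ((Submodule.Quotient.mk_eq_zero _).1 ((hg a b).symm.trans h))
      refine ⟨Submodule.Quotient.mk (a - u), Prod.ext ?_ ?_⟩
      · exact (Submodule.Quotient.eq _).2 (by simpa using hu)
      · exact (Submodule.Quotient.eq _).2 (by
          have : a - u - b = v := by rw [sub_right_comm, ← huv, add_sub_cancel_left]
          rwa [this])
    · rintro ⟨x, hx⟩
      obtain ⟨x, rfl⟩ := Submodule.mkQ_surjective _ x
      rw [← hx]
      exact (hg x x).trans (by rw [sub_self]; rfl)
  · intro q
    obtain ⟨a, rfl⟩ := Submodule.mkQ_surjective _ q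
    exact ⟨(Submodule.Quotient.mk a, Submodule.Quotient.mk 0),
      (hg a 0).trans (by rw [sub_zero]; rfl)⟩
  · intro q
    obtain ⟨a, rfl⟩ := Submodule.mkQ_surjective _ q
    exact (Submodule.Quotient.mk_eq_zero _).2 (Ideal.mul_mem_right a _ hy)

end RingTheory.Sequence.IsWeaklyRegular

namespace PureSpinor

open MvPolynomial RingTheory.Sequence

variable {d d' m m' : AffWeight}

/-! ### Truncation -/

/-- The homomorphism that sets to zero the variables outside `[m, d']`. -/
noncomputable def trunc (d d' m : AffWeight) : Poly d d' →ₐ[ℂ] Poly m d' :=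
  aeval fun a : Set.Icc d d' => varOrZero m d' a

theorem trunc_X (a : Set.Icc d d') : trunc d d' m (X a) = varOrZero m d' a := aeval_X _ _

theorem trunc_varOrZero (hm : d ≤ m) (a : AffWeight) :
    trunc d d' m (varOrZero d d' a) = varOrZero m d' a := by
  by_cases ha : a ∈ Set.Icc d d'
  · rw [varOrZero_of_mem ha, trunc_X]
  · rw [varOrZero_of_notMem ha, map_zero, varOrZero_of_notMem fun h => ha ⟨hm.trans h.1, h.2⟩]

theorem trunc_rel (hm : d ≤ m) (s : VecIndex) (l : ℤ) :
    trunc d d' m (rel d d' s l) = rel m d' s l := by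
  have h1 : mapGenFun (trunc d d' m : Poly d d' →+* Poly m d') = genFun m d' := by
    funext α
    refine LaurentPolynomial.ext fun l => ?_
    rw [coeff_mapGenFun, coeff_genFun]
    exact trunc_varOrZero hm _
  rw [rel, rel, ← h1]
  unfold mapGenFun
  rw [← map_Gam, AddMonoidAlgebra.coeff_mapRingHom]
  rfl

/-- The ideal of the closed subscheme defined by the vanishing of the coordinates
outside `[m, d']`. -/
noncomputable def truncIdeal (d d' m : AffWeight) : Ideal (Poly d d') :=
  (relIdeal m d').comap (trunc d d' m)

theorem relIdeal_le_truncIdeal (hm : d ≤ m) : relIdeal d d' ≤ truncIdeal d d' m := by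
  refine Ideal.span_le.2 ?_
  rintro _ ⟨⟨s, l⟩, rfl⟩
  refine Ideal.mem_comap.2 ?_
  rw [trunc_rel hm]
  exact Ideal.subset_span ⟨(s, l), rfl⟩

theorem truncIdeal_self : truncIdeal d d' d = relIdeal d d' := by
  have : trunc d d' d = AlgHom.id ℂ _ := by
    ext a
    rw [trunc_X, varOrZero_of_mem a.2]
    rfl
  rw [truncIdeal, this]
  exact Ideal.comap_id _

/-- Modulo the relations every polynomial is standard, and `f` is injective on standard polynomials,
so its kernel can contain nothing else. -/
theorem mem_relIdeal_iff (n : ℕ) (f : Poly d d' →ₐ[ℂ] MvPolynomial (Fin n) ℂ)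
    (hf : ∀ s, Gam s (mapGenFun (f : Poly d d' →+* MvPolynomial (Fin n) ℂ)) = 0)
    (hinj : ∀ p ∈ stdSubmodule (Set.Icc d d'), f p = 0 → p = 0) (p : Poly d d') :
    p ∈ relIdeal d d' ↔ f p = 0 := by
  refine ⟨fun h => relIdeal_le_ker _ hf h, fun h => ?_⟩
  obtain ⟨q, hq, hpq⟩ := exists_std p
  have h1 : f (p - q) = 0 := relIdeal_le_ker _ hf hpq
  rw [map_sub, h, zero_sub, neg_eq_zero] at h1
  rwa [hinj q hq h1, sub_zero] at hpq

/-- The algebra of an interval embeds into a polynomial ring. -/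
theorem exists_ker_eq (n : ℕ) (hd : d ≤ d') (hn : ht d' - ht d = n) :
    ∃ f : Poly d d' →ₐ[ℂ] MvPolynomial (Fin (n + 1)) ℂ, ∀ p, p ∈ relIdeal d d' ↔ f p = 0 := by
  obtain ⟨f, hf, hinj⟩ := exists_embedding n hd hn
  exact ⟨f, mem_relIdeal_iff _ f hf hinj⟩

theorem exists_nat_ht (hd : d ≤ d') : ∃ n : ℕ, ht d' - ht d = n :=
  ⟨(ht d' - ht d).toNat, by have := ht_mono hd; lia⟩

theorem isPrime_relIdeal (hd : d ≤ d') : (relIdeal d d').IsPrime := by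
  obtain ⟨n, hn⟩ := exists_nat_ht hd
  obtain ⟨f, hf⟩ := exists_ker_eq n hd hn
  have : relIdeal d d' = RingHom.ker f := by
    ext p
    rw [hf, RingHom.mem_ker]
  rw [this]
  exact RingHom.ker_isPrime f

theorem isPrime_truncIdeal (hm : m ≤ d') : (truncIdeal d d' m).IsPrime :=
  have := isPrime_relIdeal hm
  Ideal.comap_isPrime _ _

theorem eq_zero_of_mem_relIdeal (hd : d ≤ d') {p : Poly d d'}
    (hp : p ∈ stdSubmodule (Set.Icc d d')) (h : p ∈ relIdeal d d') : p = 0 := by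
  obtain ⟨n, hn⟩ := exists_nat_ht hd
  obtain ⟨f, hf, hinj⟩ := exists_embedding n hd hn
  exact hinj p hp (relIdeal_le_ker _ hf h)

/-- The inclusion of an upper interval. -/
def inclIcc (hm : d ≤ m) (a : Set.Icc m d') : Set.Icc d d' := ⟨a.1, hm.trans a.2.1, a.2.2⟩

theorem inclIcc_injective (hm : d ≤ m) :
    Function.Injective (inclIcc hm : Set.Icc m d' → Set.Icc d d') := fun _ _ h =>
  Subtype.ext (congrArg (fun x : Set.Icc d d' => x.1) h)

theorem monomial_mem_truncIdeal {s : Set.Icc d d' →₀ ℕ} (c : ℂ) {a : Set.Icc d d'} (ha : s a ≠ 0)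
    (hma : ¬ m ≤ a.1) : monomial s c ∈ truncIdeal d d' m := by
  refine Ideal.mem_comap.2 ?_
  rw [trunc, aeval_monomial, Finsupp.prod,
    Finset.prod_eq_zero (Finsupp.mem_support_iff.2 ha), mul_zero]
  · exact zero_mem _
  · rw [varOrZero_of_notMem fun h => hma h.1, zero_pow ha]

theorem exists_mapDomain_or (hm : d ≤ m) (s : Set.Icc d d' →₀ ℕ) :
    (∃ a, s a ≠ 0 ∧ ¬ m ≤ a.1) ∨ ∃ t : Set.Icc m d' →₀ ℕ, s = t.mapDomain (inclIcc hm) := by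
  by_cases h : ∃ a, s a ≠ 0 ∧ ¬ m ≤ a.1
  · exact Or.inl h
  · push Not at h
    refine Or.inr ⟨s.comapDomain (inclIcc hm) (inclIcc_injective hm).injOn,
      (Finsupp.mapDomain_comapDomain _ (inclIcc_injective hm) s fun a ha => ?_).symm⟩
    exact ⟨⟨a.1, h a (Finsupp.mem_support_iff.1 ha), a.2.2⟩, rfl⟩

theorem coeff_trunc (hm : d ≤ m) (p : Poly d d') (t : Set.Icc m d' →₀ ℕ) :
    coeff t (trunc d d' m p) = coeff (t.mapDomain (inclIcc hm)) p := by
  classical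
  induction p using MvPolynomial.induction_on' with
  | add p q hp hq => rw [map_add, coeff_add, coeff_add, hp, hq]
  | monomial s c =>
    rcases exists_mapDomain_or hm s with ⟨a, ha, hma⟩ | ⟨u, rfl⟩
    · have h0 : trunc d d' m (monomial s c) = 0 := by
        rw [trunc, aeval_monomial, Finsupp.prod,
          Finset.prod_eq_zero (Finsupp.mem_support_iff.2 ha), mul_zero]
        rw [varOrZero_of_notMem fun h => hma h.1, zero_pow ha]
      rw [h0, coeff_zero, coeff_monomial, if_neg]
      rintro rfl
      obtain ⟨b, hb, rfl⟩ := Finset.mem_image.1 (Finsupp.mapDomain_support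
        (Finsupp.mem_support_iff.2 ha))
      exact hma b.2.1
    · have h1 : trunc d d' m (monomial (u.mapDomain (inclIcc hm)) c) = monomial u c := by
        rw [← rename_monomial, ← AlgHom.comp_apply]
        have : (trunc d d' m).comp (rename (inclIcc hm)) = AlgHom.id ℂ (Poly m d') := by
          ext a
          rw [AlgHom.comp_apply, rename_X, trunc_X, AlgHom.id_apply]
          rw [varOrZero_of_mem (show (inclIcc hm a).1 ∈ Set.Icc m d' from a.2)]
          rfl
        rw [this, AlgHom.id_apply]
      rw [h1, coeff_monomial, coeff_monomial]
      exact if_congr (Finsupp.mapDomain_injective (inclIcc_injective hm)).eq_iff.symm rfl rfl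

/-- A combination of standard monomials lies in a truncation ideal if and only if each monomial
does so trivially. -/
theorem exists_not_le_of_mem_truncIdeal (hm : d ≤ m) (hmd : m ≤ d') {p : Poly d d'}
    (hp : p ∈ stdSubmodule (Set.Icc d d')) (h : p ∈ truncIdeal d d' m)
    {s : Set.Icc d d' →₀ ℕ} (hs : s ∈ p.support) : ∃ a, s a ≠ 0 ∧ ¬ m ≤ a.1 := by
  classical
  refine (exists_mapDomain_or hm s).resolve_right ?_
  rintro ⟨t, rfl⟩
  -- Truncation kills a monomial or keeps it unchanged, so the truncated polynomial is still
  -- standard, and independence on `[m, d']` applies.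
  have h0 : trunc d d' m p = 0 := by
    refine eq_zero_of_mem_relIdeal hmd (fun u hu a ha b hb hab => ?_) h
    rw [mem_support_iff, coeff_trunc hm] at hu
    have hmem : ∀ x : Set.Icc m d', x ∈ (u.support : Set (Set.Icc m d')) →
        inclIcc hm x ∈ ((u.mapDomain (inclIcc hm)).support : Set (Set.Icc d d')) := fun x hx => by
      rw [Finset.mem_coe, Finsupp.mem_support_iff,
        Finsupp.mapDomain_apply (inclIcc_injective hm)]
      exact Finsupp.mem_support_iff.1 hx
    exact hp _ (mem_support_iff.2 hu) (hmem a ha) (hmem b hb) ((inclIcc_injective hm).ne hab)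
  rw [mem_support_iff, ← coeff_trunc hm, h0, coeff_zero] at hs
  exact hs rfl

/-- Both ideals contain the relations, so they may be compared on standard representatives. This
lets truncation ideals be treated like monomial ideals. -/
theorem le_of_forall_monomial {I K : Ideal (Poly d d')} (hrI : relIdeal d d' ≤ I)
    (hrK : relIdeal d d' ≤ K)
    (h : ∀ p ∈ stdSubmodule (Set.Icc d d'), p ∈ I → ∀ s ∈ p.support, monomial s 1 ∈ K) :
    I ≤ K := by
  intro p hp
  obtain ⟨q, hq, hpq⟩ := exists_std p
  have hqI : q ∈ I := by
    have := I.sub_mem hp (hrI hpq)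
    rwa [sub_sub_cancel] at this
  have hqK : q ∈ K := by
    rw [q.as_sum]
    refine K.sum_mem fun s hs => ?_
    rw [← mul_one (coeff s q), ← C_mul_monomial]
    exact K.mul_mem_left _ (h q hq hqI s hs)
  simpa using K.add_mem (hrK hpq) hqK

theorem truncIdeal_mono (hm : d ≤ m) (hmm' : m ≤ m') (hm' : m' ≤ d') :
    truncIdeal d d' m ≤ truncIdeal d d' m' := by
  refine le_of_forall_monomial (relIdeal_le_truncIdeal hm)
    (relIdeal_le_truncIdeal (hm.trans hmm')) fun p hp hpI s hs => ?_
  obtain ⟨a, ha, hma⟩ := exists_not_le_of_mem_truncIdeal hm (hmm'.trans hm') hp hpI hs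
  exact monomial_mem_truncIdeal 1 ha fun h => hma (hmm'.trans h)

theorem truncIdeal_sup {m₁ m₂ e : AffWeight} (h1 : d ≤ m₁) (h2 : d ≤ m₂) (he : e ≤ d')
    (hjoin : ∀ x, m₁ ≤ x ∧ m₂ ≤ x ↔ e ≤ x) :
    truncIdeal d d' m₁ ⊔ truncIdeal d d' m₂ = truncIdeal d d' e := by
  obtain ⟨h1e, h2e⟩ := (hjoin e).2 le_rfl
  refine le_antisymm (sup_le (truncIdeal_mono h1 h1e he) (truncIdeal_mono h2 h2e he)) ?_
  refine le_of_forall_monomial (relIdeal_le_truncIdeal (h1.trans h1e))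
    ((relIdeal_le_truncIdeal h1).trans le_sup_left) fun p hp hpI s hs => ?_
  obtain ⟨a, ha, hea⟩ := exists_not_le_of_mem_truncIdeal (h1.trans h1e) he hp hpI hs
  rw [← hjoin, not_and_or] at hea
  rcases hea with hea | hea
  · exact Ideal.mem_sup_left (monomial_mem_truncIdeal 1 ha hea)
  · exact Ideal.mem_sup_right (monomial_mem_truncIdeal 1 ha hea)

/-! ### Rank sums -/

/-- The sum of the variables of a given height. -/
noncomputable def rankSumPoly (d d' : AffWeight) (i : ℤ) : Poly d d' :=
  ∑ a : Set.Icc d d', if ht a.1 = i then X a else 0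

theorem rankSumPoly_mem_truncIdeal {i : ℤ} (h : i < ht m) :
    rankSumPoly d d' i ∈ truncIdeal d d' m := by
  refine Ideal.sum_mem _ fun a _ => ?_
  split_ifs with ha
  · refine monomial_mem_truncIdeal (a := a) 1 (by simp) fun hma => ?_
    have := ht_mono hma
    lia
  · exact zero_mem _

theorem eq_of_le_of_ht_le {a b : AffWeight} (h : a ≤ b) (h' : ht b ≤ ht a) : a = b :=
  (ht_le_of_path h).resolve_right (by lia)

/-- Among the elements of its height, `m` is the only one above `m`, so all other summands vanish
under truncation. -/
theorem rankSumPoly_sub_X_mem_truncIdeal (h : m ∈ Set.Icc d d') :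
    rankSumPoly d d' (ht m) - X ⟨m, h⟩ ∈ truncIdeal d d' m := by
  classical
  rw [rankSumPoly, ← Finset.add_sum_erase _ _ (Finset.mem_univ ⟨m, h⟩), if_pos rfl,
    add_sub_cancel_left]
  refine Ideal.sum_mem _ fun a ha => ?_
  split_ifs with hh
  · refine monomial_mem_truncIdeal (a := a) 1 (by simp) fun hma => ?_
    exact (Finset.mem_erase.1 ha).1 (Subtype.ext (eq_of_le_of_ht_le hma hh.le).symm)
  · exact zero_mem _

theorem X_notMem_truncIdeal (h : m ∈ Set.Icc d d') :
    (X ⟨m, h⟩ : Poly d d') ∉ truncIdeal d d' m := by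
  classical
  intro hc
  have hstd : (X ⟨m, h⟩ : Poly d d') ∈ stdSubmodule (Set.Icc d d') :=
    monomial_mem_stdSubmodule 1 fun a ha b hb hab => by
      have h1 := Finsupp.support_single_subset ha
      have h2 := Finsupp.support_single_subset hb
      simp only [Finset.mem_singleton] at h1 h2
      exact absurd (h1.trans h2.symm) hab
  obtain ⟨a, ha, hma⟩ := exists_not_le_of_mem_truncIdeal h.1 h.2 hstd hc
    (s := Finsupp.single ⟨m, h⟩ 1) (by rw [mem_support_iff]; simp [X])
  rw [Finsupp.single_apply_ne_zero] at ha
  exact hma (ha.1 ▸ le_rfl)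

theorem mem_truncIdeal_of_rankSumPoly_mul_mem (h : m ∈ Set.Icc d d') {x : Poly d d'}
    (hx : rankSumPoly d d' (ht m) * x ∈ truncIdeal d d' m) : x ∈ truncIdeal d d' m := by
  refine ((isPrime_truncIdeal h.2).mem_or_mem hx).resolve_left fun hc => ?_
  refine X_notMem_truncIdeal h ?_
  have := (truncIdeal d d' m).sub_mem hc (rankSumPoly_sub_X_mem_truncIdeal h)
  rwa [sub_sub_cancel] at this

theorem X_mem_sup (h : m ∈ Set.Icc d d') :
    (X ⟨m, h⟩ : Poly d d') ∈ truncIdeal d d' m ⊔ Ideal.span {rankSumPoly d d' (ht m)} := by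
  rw [← sub_sub_cancel (rankSumPoly d d' (ht m)) (X ⟨m, h⟩)]
  exact sub_mem (Ideal.mem_sup_right (Ideal.mem_span_singleton_self _))
    (Ideal.mem_sup_left (rankSumPoly_sub_X_mem_truncIdeal h))

theorem monomial_mem_sup_rankSumPoly (h : m ∈ Set.Icc d d') {s : Set.Icc d d' →₀ ℕ}
    {a : Set.Icc d d'} (ha : s a ≠ 0) (hma : ¬ m < a.1) :
    monomial s (1 : ℂ) ∈ truncIdeal d d' m ⊔ Ideal.span {rankSumPoly d d' (ht m)} := by
  by_cases hle : m ≤ a.1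
  · have ham : a = ⟨m, h⟩ := Subtype.ext (eq_of_le_of_not_lt hle hma).symm
    rw [ham] at ha
    obtain ⟨q, hq⟩ := (X_dvd_monomial (r := (1 : ℂ))).2 (Or.inr ha)
    rw [hq]
    exact Ideal.mul_mem_right _ _ (X_mem_sup h)
  · exact Ideal.mem_sup_left (monomial_mem_truncIdeal 1 ha hle)

theorem truncIdeal_sup_eq_of_unique_cover {b : AffWeight} (h : m ∈ Set.Icc d d') (hmb : m < b)
    (hb : b ≤ d') (hht : ht m < ht b) (hcov : ∀ x, m < x → x ≤ d' → b ≤ x) :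
    truncIdeal d d' m ⊔ Ideal.span {rankSumPoly d d' (ht m)} = truncIdeal d d' b := by
  refine le_antisymm (sup_le (truncIdeal_mono h.1 hmb.le hb) ?_) ?_
  · exact (Ideal.span_singleton_le_iff_mem _).2 (rankSumPoly_mem_truncIdeal hht)
  · refine le_of_forall_monomial (relIdeal_le_truncIdeal (h.1.trans hmb.le))
      ((relIdeal_le_truncIdeal h.1).trans le_sup_left) fun p hp hpI s hs => ?_
    obtain ⟨a, ha, hba⟩ := exists_not_le_of_mem_truncIdeal (h.1.trans hmb.le) hb hp hpI hs
    exact monomial_mem_sup_rankSumPoly h ha fun hma => hba (hcov _ hma a.2.2)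

/-- A standard monomial in both ideals contains some `x` not above `b` and some `y` not above `c`.
If both were above `m` strictly, then `c ≤ x` and `b ≤ y`, and comparability of `x` and `y` on a
chain would be contradictory. So one of them is `m` or is not above `m`. -/
theorem truncIdeal_sup_eq_of_two_covers {b c : AffWeight} (h : m ∈ Set.Icc d d') (hmb : m < b)
    (hmc : m < c) (hb : b ≤ d') (hc : c ≤ d') (hhtb : ht m < ht b) (hhtc : ht m < ht c)
    (hcov : ∀ x, m < x → b ≤ x ∨ c ≤ x) :
    truncIdeal d d' m ⊔ Ideal.span {rankSumPoly d d' (ht m)} =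
      truncIdeal d d' b ⊓ truncIdeal d d' c := by
  refine le_antisymm (sup_le (le_inf (truncIdeal_mono h.1 hmb.le hb)
    (truncIdeal_mono h.1 hmc.le hc)) ?_) ?_
  · exact (Ideal.span_singleton_le_iff_mem _).2
      ⟨rankSumPoly_mem_truncIdeal hhtb, rankSumPoly_mem_truncIdeal hhtc⟩
  · refine le_of_forall_monomial (le_inf (relIdeal_le_truncIdeal (h.1.trans hmb.le))
      (relIdeal_le_truncIdeal (h.1.trans hmc.le)))
      ((relIdeal_le_truncIdeal h.1).trans le_sup_left) fun p hp hpI s hs => ?_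
    obtain ⟨x, hx, hbx⟩ := exists_not_le_of_mem_truncIdeal (h.1.trans hmb.le) hb hp hpI.1 hs
    obtain ⟨y, hy, hcy⟩ := exists_not_le_of_mem_truncIdeal (h.1.trans hmc.le) hc hp hpI.2 hs
    by_cases hmx : m < x.1
    · refine monomial_mem_sup_rankSumPoly h hy fun hmy => ?_
      have hcx := (hcov _ hmx).resolve_left hbx
      have hby := (hcov _ hmy).resolve_right hcy
      have hne : x ≠ y := by rintro rfl; exact hbx hby
      rcases hp s hs (Finsupp.mem_support_iff.2 hx) (Finsupp.mem_support_iff.2 hy) hne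
        with hxy | hxy
      · exact hcy (hcx.trans hxy)
      · exact hbx (hby.trans hxy)
    · exact monomial_mem_sup_rankSumPoly h hx hmx

/-- The list of `k` consecutive rank sums that starts at height `h`. -/
noncomputable def rankSums (d d' : AffWeight) (h : ℤ) : ℕ → List (Poly d d')
  | 0 => []
  | k + 1 => rankSumPoly d d' h :: rankSums d d' (h + 1) k

theorem rankSums_eq_ofFn (h : ℤ) (k : ℕ) :
    rankSums d d' h k = List.ofFn fun j : Fin k => rankSumPoly d d' (h + (j : ℕ)) := by
  induction k generalizing h with
  | zero => simp [rankSums]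
  | succ k ih =>
    rw [rankSums, ih, List.ofFn_succ]
    simp only [Fin.val_zero, Nat.cast_zero, add_zero, Fin.val_succ, Nat.cast_add, Nat.cast_one]
    congr 2
    funext j
    congr 1
    ring

/-- The rank sums form a weakly regular sequence on the coordinate ring of every upper interval. -/
theorem isWeaklyRegular_rankSums (k : ℕ) (h : m ∈ Set.Icc d d') (hk : ht d' - ht m = k) :
    IsWeaklyRegular (Poly d d' ⧸ truncIdeal d d' m) (rankSums d d' (ht m) (k + 1)) := by
  induction k using Nat.strong_induction_on generalizing m with
  | _ k ih =>
    rw [rankSums, IsWeaklyRegular.quotient_cons_iff]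
    refine ⟨fun x hx => mem_truncIdeal_of_rankSumPoly_mul_mem h hx, ?_⟩
    rcases eq_or_lt_of_le h.2 with rfl | hlt
    · obtain rfl : k = 0 := by lia
      exact .nil _ _
    rcases covers_of_lt hlt with ⟨b, hb, hmb, hbd, hcov⟩ |
      ⟨b, c, e, hb, hc, he, hmb, hmc, hbd, hcd, hed, hcov, hjoin⟩
    · have hk1 : ht b ≤ ht d' := ht_mono hbd
      obtain ⟨k, rfl⟩ : ∃ k', k = k' + 1 := ⟨k - 1, by lia⟩
      rw [truncIdeal_sup_eq_of_unique_cover h hmb hbd (by lia) hcov, ← hb]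
      exact ih k (by lia) ⟨h.1.trans hmb.le, hbd⟩ (by lia)
    · have hk1 : ht e ≤ ht d' := ht_mono hed
      -- The join lies two heights above `m`. The next rank sum, of height `ht m + 1`, therefore
      -- vanishes on its quotient, as `quotient_inf` requires, and the sequence there starts one
      -- entry later.
      obtain ⟨k, rfl⟩ : ∃ k', k = k' + 2 := ⟨k - 2, by lia⟩
      have h1 := ih (k + 1) (by lia) ⟨h.1.trans hmb.le, hbd⟩ (by push_cast at hk ⊢; lia)
      have h2 := ih (k + 1) (by lia) ⟨h.1.trans hmc.le, hcd⟩ (by push_cast at hk ⊢; lia)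
      have h3 := ih k (by lia) ⟨(h.1.trans hmb.le).trans ((hjoin e).2 le_rfl).1, hed⟩
        (by push_cast at hk ⊢; lia)
      have hsup := truncIdeal_sup (d' := d') (h.1.trans hmb.le) (h.1.trans hmc.le) hed hjoin
      rw [truncIdeal_sup_eq_of_two_covers h hmb hmc hbd hcd (by lia) (by lia) hcov]
      rw [hb] at h1
      rw [hc] at h2
      rw [he, ← hsup, show ht m + 2 = ht m + 1 + 1 by ring] at h3
      refine IsWeaklyRegular.quotient_inf ?_ h1 h2 h3
      rw [hsup]
      exact rankSumPoly_mem_truncIdeal (by lia)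

/-! ### Dimension -/

/-- A regular element avoids the minimal primes of the support, so each quotient lowers the
dimension of the support by at least one. -/
theorem length_le_supportDim_of_isRegular {R : Type*} [CommRing R] {M : Type*} [AddCommGroup M]
    [Module R M] [Module.Finite R M] (rs : List R) (h : IsRegular M rs) :
    (rs.length : WithBot ℕ∞) ≤ Module.supportDim R M := by
  induction rs generalizing M with
  | nil =>
    have := h.nontrivial
    have : Nonempty (Module.support R M) := Module.nonempty_support_of_nontrivial.to_subtype
    exact Order.krullDim_nonneg
  | cons r rs ih =>
    rw [isRegular_cons_iff] at h
    have h1 := Module.supportDim_quotSMulTop_succ_le_of_notMem_minimalPrimes (M := M) (x := r)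
      fun _ => h.1.notMem_of_mem_minimalPrimes
    refine le_trans ?_ h1
    rw [List.length_cons, Nat.cast_succ]
    gcongr
    exact ih h.2

theorem length_le_ringKrullDim_of_isRegular {R : Type*} [CommRing R] (rs : List R)
    (h : IsRegular R rs) : (rs.length : WithBot ℕ∞) ≤ ringKrullDim R :=
  (length_le_supportDim_of_isRegular rs h).trans_eq (Module.supportDim_self_eq_ringKrullDim R)

theorem ringKrullDim_le_of_isIntegral {R S : Type*} [CommRing R] [CommRing S] (f : R →+* S)
    (hf : f.IsIntegral) : ringKrullDim S ≤ ringKrullDim R := by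
  let _ : Algebra R S := f.toAlgebra
  have : Algebra.IsIntegral R S := ⟨hf⟩
  exact Order.krullDim_le_of_strictMono (PrimeSpectrum.comap (algebraMap R S))
    fun p q hpq => Ideal.IsIntegral.comap_lt_comap (I := p.asIdeal) (J := q.asIdeal) hpq

/-- An algebra of finite type that embeds into a polynomial ring in `n` variables has dimension at
most `n`. -/
theorem ringKrullDim_le_of_injective {k A : Type} [Field k] [CommRing A] [Algebra k A]
    [Algebra.FiniteType k A] [Nontrivial A] (n : ℕ) (f : A →ₐ[k] MvPolynomial (Fin n) k)
    (hf : Function.Injective f) : ringKrullDim A ≤ n := by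
  -- Noether normalization: `A` is integral over a polynomial ring in `s` variables, and comparing
  -- transcendence degrees gives `s ≤ n`.
  obtain ⟨s, g, hg, hint⟩ := exists_integral_inj_algHom_of_fg k A
  have hs : s ≤ n := by
    have h := trdeg_le_of_injective (f.comp g) (hf.comp hg)
    rw [MvPolynomial.trdeg_of_isDomain, MvPolynomial.trdeg_of_isDomain] at h
    simpa using h
  refine (ringKrullDim_le_of_isIntegral _ hint).trans ?_
  rw [MvPolynomial.ringKrullDim_of_isNoetherianRing, ringKrullDim_eq_zero_of_field]
  simpa using hs

theorem ringKrullDim_alg_le (n : ℕ) (hd : d ≤ d') (hn : ht d' - ht d = n) :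
    ringKrullDim (Alg d d') ≤ ((n + 1 : ℕ) : WithBot ℕ∞) := by
  obtain ⟨f, hf⟩ := exists_ker_eq n hd hn
  have := isPrime_relIdeal hd
  refine ringKrullDim_le_of_injective (k := ℂ) (n + 1)
    (Ideal.Quotient.liftₐ (relIdeal d d') f fun p hp => (hf p).1 hp) ?_
  rw [injective_iff_map_eq_zero]
  intro x hx
  obtain ⟨p, rfl⟩ := Ideal.Quotient.mk_surjective x
  exact Ideal.Quotient.eq_zero_iff_mem.2 ((hf p).2 hx)

/-! ### The generators -/

theorem relIdeal_le_ker_constantCoeff :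
    relIdeal d d' ≤ RingHom.ker (constantCoeff : Poly d d' →+* ℂ) := by
  refine Ideal.span_le.2 ?_
  rintro _ ⟨⟨s, l⟩, rfl⟩
  change constantCoeff (rel d d' s l) = 0
  rw [rel_eq_sum, map_sum]
  refine Finset.sum_eq_zero fun t _ => ?_
  split_ifs <;> simp

theorem genIdeal_ne_top : genIdeal d d' ≠ ⊤ := by
  intro h
  have hle : genIdeal d d' ≤ RingHom.ker (Ideal.Quotient.lift (relIdeal d d')
      (constantCoeff : Poly d d' →+* ℂ) fun _ h => relIdeal_le_ker_constantCoeff h) := by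
    refine Ideal.span_le.2 ?_
    rintro _ ⟨a, rfl⟩
    exact (Ideal.Quotient.lift_mk ..).trans (constantCoeff_X ℂ a)
  rw [h, top_le_iff] at hle
  exact RingHom.ker_ne_top _ hle

theorem rankSum_mem_genIdeal (i : ℤ) : rankSum d d' i ∈ genIdeal d d' := by
  refine Ideal.sum_mem _ fun a _ => ?_
  split_ifs
  · exact Ideal.subset_span ⟨a, rfl⟩
  · exact zero_mem _

theorem mk_rankSumPoly (i : ℤ) :
    algebraMap (Poly d d') (Alg d d') (rankSumPoly d d' i) = rankSum d d' i := by
  rw [rankSumPoly, rankSum, map_sum]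
  refine Finset.sum_congr rfl fun a _ => ?_
  split_ifs
  · rfl
  · exact map_zero _

theorem isRegular_rankSum (n : ℕ) (hd : d ≤ d') (hn : ht d' - ht d = n) :
    IsRegular (Alg d d') (List.ofFn fun k : Fin (n + 1) => rankSum d d' (ht d + (k : ℕ))) := by
  refine ⟨?_, fun htop => ?_⟩
  · have h := isWeaklyRegular_rankSums (d := d) n ⟨le_rfl, hd⟩ hn
    rw [truncIdeal_self, ← isWeaklyRegular_map_algebraMap_iff (Alg d d'), rankSums_eq_ofFn,
      List.map_ofFn] at h
    simpa only [Function.comp_def, mk_rankSumPoly] using h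
  -- Weak regularity becomes regularity because the rank sums lie in the proper ideal of the
  -- generators.
  · refine genIdeal_ne_top (d := d) (d' := d') (top_le_iff.1 ?_)
    rw [smul_eq_mul, Ideal.mul_top] at htop
    rw [htop, Ideal.ofList, Ideal.span_le]
    intro x hx
    obtain ⟨k, rfl⟩ := (List.mem_ofFn' _ _).1 hx
    exact rankSum_mem_genIdeal _

end PureSpinor

/-! ### Comparison of depth, dimension and the length of the rank-sum sequence -/

theorem propositionP (d d' : PureSpinor.AffWeight) (hdd' : d ≤ d') :
    ∃ n : ℕ, (n : ℤ) = PureSpinor.ht d' - PureSpinor.ht d + 1 ∧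
      PureSpinor.depth d d' = (n : ℕ∞) ∧
      topologicalKrullDim (PrimeSpectrum (PureSpinor.Alg d d')) = (n : WithBot ℕ∞) ∧
      RingTheory.Sequence.IsRegular (PureSpinor.Alg d d')
        (List.ofFn fun k : Fin n => PureSpinor.rankSum d d' (PureSpinor.ht d + (k : ℕ))) := by
  obtain ⟨n, hn⟩ := PureSpinor.exists_nat_ht hdd'
  have hreg := PureSpinor.isRegular_rankSum n hdd' hn
  have hdim : ringKrullDim (PureSpinor.Alg d d') = ((n + 1 : ℕ) : WithBot ℕ∞) := by
    refine le_antisymm (PureSpinor.ringKrullDim_alg_le n hdd' hn) ?_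
    simpa using PureSpinor.length_le_ringKrullDim_of_isRegular _ hreg
  refine ⟨n + 1, by push_cast; lia, le_antisymm ?_ ?_, ?_, hreg⟩
  · refine iSup_le fun rs => iSup_le fun hrs => iSup_le fun _ => ?_
    have := PureSpinor.length_le_ringKrullDim_of_isRegular rs hrs
    rw [hdim] at this
    exact_mod_cast this
  · refine le_trans ?_ (le_iSup_of_le (List.ofFn fun k : Fin (n + 1) =>
      PureSpinor.rankSum d d' (PureSpinor.ht d + (k : ℕ))) (le_iSup_of_le hreg
      (le_iSup_of_le (fun r hr => ?_) le_rfl)))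
    · rw [List.length_ofFn]
    · obtain ⟨k, rfl⟩ := (List.mem_ofFn' _ _).1 hr
      exact PureSpinor.rankSum_mem_genIdeal _
  · rw [PrimeSpectrum.topologicalKrullDim_eq_ringKrullDim, hdim]
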